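/- Let $k$ be a field with $\frac16\in k$ and let $n\ge 1$. For $r\ge 0$ put $X_r=\mathbb A^1_k\times(\mathbb P^1_k\setminus\{1\})^r$, with coordinates $x,y_1,\dots,y_r$; its faces are the divisors $y_i=0$ and $y_i=\infty$. Let $\mathcal Z_0(X_r)$ be the free abelian group on the closed points of $X_r$ that lie neither on $\{x=0\}$ nor on a face. For $r\ge 1$ let $\mathcal Z_1(X_r)$ be the free abelian group on the integral closed curves $C\subset X_r$, contained neither in $\{x=0\}$ nor in a face, such that (i) for all $i$, the intersection cycles $\partial_i^0C$ and $\partial_i^\infty C$ of $C$ with the faces $y_i=0$ and $y_i=\infty$, each face being identified with $X_{r-1}$, lie in $\mathcal Z_0(X_{r-1})$, that is, every point of these intersections lies off $\{x=0\}$ and off the faces of $X_{r-1}$; (ii) (modulus $2$) if $\nu:\overline C\to\mathbb P^1\times(\mathbb P^1)^r$ is the normalisation of the closure of $C$, then at every closed point $P\in\overline C$ with $x(\nu(P))=0$ one has $$2\,\mathrm{ord}_P(x)+\sum_{j=1}^r|\mathrm{ord}_P(y_j)|\ \le\ \max_{1\le i\le r}\mathrm{ord}_P(y_i-1).$$ Let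 $\partial=\sum_{i=1}^r(-1)^i(\partial_i^0-\partial_i^\infty):\mathcal Z_1(X_r)\to\mathcal Z_0(X_{r-1})$ and $$TH^n_M(k,n)=\mathcal Z_0(X_{n-1})/\partial\mathcal Z_1(X_n).$$ For $a\in k$ and $b_1,\dots,b_{n-1}\in k^\times$ let $[a;b_1,\dots,b_{n-1}]\in TH^n_M(k,n)$ be the class of the rational point $(x,y_1,\dots,y_{n-1})=(\frac1a,b_1,\dots,b_{n-1})$ if $a\ne 0$ and all $b_i\neq 1$, and $0$ if $a=0$ or some $b_i=1$. Let $\Omega^{n-1}_k=\bigwedge^{n-1}_k\Omega^1_{k/\mathbb Z}$ be the absolute Kähler differentials. Then $a\otimes(b_1\wedge\dots\wedge b_{n-1})\mapsto[a;b_1,\dots,b_{n-1}]$ is a well-defined homomorphism $$\Phi:k\otimes_{\mathbb Z}\textstyle\bigwedge^{n-1}_{\mathbb Z}k^\times\to TH^n_M(k,n),$$ and it factors through $$k\otimes_{\mathbb Z}\textstyle\bigwedge^{n-1}_{\mathbb Z}k^\times\to\Omega^{n-1}_k,\qquad a\otimes(b_1\wedge\dots\wedge b_{n-1})\mapsto a\,\frac{db_1}{b_1}\wedge\dots\wedge\frac{db_{n-1}}{b_{n-1}};$$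 that is, there is a homomorphism of abelian groups $\varphi:\Omega^{n-1}_k\to TH^n_M(k,n)$ whose composition with this map is $\Phi$. -/

import Mathlib

open scoped TensorProduct KaehlerDifferential

noncomputable section

namespace AdditiveChow

/-- The coordinate ring of `X_n = 𝔸¹ × (ℙ¹ ∖ {1})ⁿ` over `k`. Write `x` for the coordinate of `𝔸¹`
and `y_i` for the standard coordinate of the `i`-th `ℙ¹`. Then `ℙ¹ ∖ {1}` is an affine line with
coordinate `u_i = y_i / (y_i - 1)`, and conversely `y_i = u_i / (u_i - 1)`. The point `y_i = 0` is
`u_i = 0`, and the point `y_i = ∞` is `u_i = 1`. So `X_n` is the spectrum of `k[x, u_1, …, u_n]`. -/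
abbrev CoordRing (k : Type*) [Field k] (n : ℕ) : Type _ := MvPolynomial (Option (Fin n)) k

section Cycles

variable (k : Type*) [Field k]

/-- The coordinate `x` of `𝔸¹`, as a function on `X_n`. -/
def coordX (n : ℕ) : CoordRing k n := MvPolynomial.X none

/-- The coordinate `u_i = y_i / (y_i - 1)` of the `i`-th factor `ℙ¹ ∖ {1}`, as a function
on `X_n`. -/
def coordU {n : ℕ} (i : Fin n) : CoordRing k n := MvPolynomial.X (some i)

/-- Pullback of functions along the closed embedding `X_n → X_{n+1}` whose image is `u_i = c`.
The face `y_i = 0` is the case `c = 0`, the face `y_i = ∞` is the case `c = 1`. -/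
def facePullback {n : ℕ} (i : Fin (n + 1)) (c : k) : CoordRing k (n + 1) →ₐ[k] CoordRing k n :=
  MvPolynomial.aeval fun o : Option (Fin (n + 1)) =>
    o.elim (coordX k n)
      (Fin.insertNth (α := fun _ => CoordRing k n) i (MvPolynomial.C c) (fun j => coordU k j))

variable {k}

/-- A closed point `ξ` of `X_n` lies off the divisor `x = 0` and off all the faces `y_i = 0, ∞`. -/
def IsOffBoundary {n : ℕ} (ξ : MaximalSpectrum (CoordRing k n)) : Prop :=
  coordX k n ∉ ξ.asIdeal ∧
    ∀ i : Fin n, coordU k i ∉ ξ.asIdeal ∧ coordU k i - 1 ∉ ξ.asIdeal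

variable (k) in
/-- The closed points that generate the group of `0`-cycles. -/
abbrev OpenPoint (n : ℕ) : Type _ := {ξ : MaximalSpectrum (CoordRing k n) // IsOffBoundary ξ}

variable (k) in
/-- `𝓩₀(X_n)`: the free abelian group on the closed points of `X_n` off `x = 0` and off the
faces. -/
abbrev ZeroCycles (n : ℕ) : Type _ := OpenPoint k n →₀ ℤ

/-- The multiplicity of the closed point `ξ` of `X_n` in the closed subscheme defined by `J`: the
length of the local ring of that subscheme at `ξ` (`0` if `ξ` does not lie on it). -/
def multiplicityAt {n : ℕ} (J : Ideal (CoordRing k n)) (ξ : MaximalSpectrum (CoordRing k n)) : ℕ :=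
  (Module.length (Localization.AtPrime ξ.asIdeal)
    (Localization.AtPrime ξ.asIdeal ⧸
      J.map (algebraMap (CoordRing k n) (Localization.AtPrime ξ.asIdeal)))).toNat

variable (k) in
/-- An integral closed curve `C ⊆ X_n`, given by its prime ideal. -/
structure Curve (n : ℕ) where
  ideal : Ideal (CoordRing k n)
  isPrime : ideal.IsPrime
  krullDim_eq_one : ringKrullDim (CoordRing k n ⧸ ideal) = 1

attribute [instance] Curve.isPrime

namespace Curve

/-- The function field of the curve `C`. -/
abbrev FunctionField {n : ℕ} (C : Curve k n) : Type _ := FractionRing (CoordRing k n ⧸ C.ideal)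

/-- Restriction of a regular function on `X_n` to a rational function on `C`. -/
def restrict {n : ℕ} (C : Curve k n) (f : CoordRing k n) : C.FunctionField :=
  algebraMap (CoordRing k n ⧸ C.ideal) C.FunctionField (Ideal.Quotient.mk C.ideal f)

/-- The coordinate `x` as a rational function on `C`. -/
def x {n : ℕ} (C : Curve k n) : C.FunctionField := C.restrict (coordX k n)

/-- The coordinate `y_i = u_i / (u_i - 1)` as a rational function on `C` (to be used for curves that
are not contained in the face `y_i = ∞`). -/
def y {n : ℕ} (C : Curve k n) (i : Fin n) : C.FunctionField :=
  C.restrict (coordU k i) / C.restrict (coordU k i - 1)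

/-- The modulus condition with modulus `2{0}`. The closed points `P` of the normalisation `C̄` of the
closure of `C` in `ℙ¹ × (ℙ¹)ⁿ` are the nontrivial valuation rings `V` of the function field of `C`
which contain `k`, and `P` lies over `x = 0` iff `|x|_P < 1` (this rules out the trivial valuation
ring when `x ≠ 0` on `C`). At each such `P` we require
`2 ord_P(x) + ∑_j |ord_P(y_j)| ≤ max_i ord_P(y_i - 1)`. Here `|ord_P(y_j)|` is the multiplicity of `P`
in the pullback of the divisor `{y_j = 0} + {y_j = ∞}`. The condition is written multiplicatively,
in the value group of `V`. -/
def HasModulusTwo {n : ℕ} (C : Curve k n) : Prop :=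
  ∀ V : ValuationSubring C.FunctionField,
    (∀ a : k, algebraMap k C.FunctionField a ∈ V) → V.valuation C.x < 1 →
      ∃ i : Fin n, V.valuation (C.y i - 1) ≤
        V.valuation C.x ^ 2 * ∏ j : Fin n, min (V.valuation (C.y j)) (V.valuation (C.y j))⁻¹

/-- The ideal in the coordinate ring of `X_n` of the scheme-theoretic intersection of `C ⊆ X_{n+1}`
with the face `u_i = c`, the face being identified with `X_n`. -/
def faceIdeal {n : ℕ} (C : Curve k (n + 1)) (i : Fin (n + 1)) (c : k) : Ideal (CoordRing k n) :=
  C.ideal.map (facePullback k i c)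

end Curve

variable (k) in
/-- The generators of `𝓩₁(X_{n+1})`: integral curves `C ⊆ X_{n+1}`, not contained in `x = 0` or in a
face, which meet the faces `y_i = 0, ∞` in `0`-cycles belonging to `𝓩₀(X_n)` (good position) and
satisfy the modulus condition. -/
structure AdmissibleCurve (n : ℕ) extends Curve k (n + 1) where
  x_notMem : coordX k (n + 1) ∉ ideal
  zero_notMem : ∀ i : Fin (n + 1), coordU k i ∉ ideal
  infty_notMem : ∀ i : Fin (n + 1), coordU k i - 1 ∉ ideal
  goodPosition_zero : ∀ (i : Fin (n + 1)) (ξ : MaximalSpectrum (CoordRing k n)),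
    toCurve.faceIdeal i 0 ≤ ξ.asIdeal → IsOffBoundary ξ
  goodPosition_infty : ∀ (i : Fin (n + 1)) (ξ : MaximalSpectrum (CoordRing k n)),
    toCurve.faceIdeal i 1 ≤ ξ.asIdeal → IsOffBoundary ξ
  modulus : toCurve.HasModulusTwo

variable (k) in
/-- `𝓩₁(X_{n+1})`: the free abelian group on the admissible curves. -/
abbrev OneCycles (n : ℕ) : Type _ := AdmissibleCurve k n →₀ ℤ

theorem facePullback_surjective {n : ℕ} (i : Fin (n + 1)) (c : k) :
    Function.Surjective (facePullback k i c) := by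
  rw [← AlgHom.range_eq_top, eq_top_iff, ← MvPolynomial.adjoin_range_X, Algebra.adjoin_le_iff]
  rintro _ ⟨o, rfl⟩
  cases o with
  | none => exact ⟨MvPolynomial.X none, by simp [facePullback, coordX]⟩
  | some j => exact ⟨MvPolynomial.X (some (i.succAbove j)), by simp [facePullback, coordU]⟩

theorem facePullback_coordU {n : ℕ} (i : Fin (n + 1)) (c : k) :
    facePullback k i c (coordU k i - MvPolynomial.C c) = 0 := by
  simp [facePullback, coordU, ← MvPolynomial.algebraMap_eq]

/-- In a Noetherian domain of dimension at most one, a nonzero element lies in only finitely many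
primes. -/
theorem finite_primes_of_mem {A : Type*} [CommRing A] [IsDomain A] [IsNoetherianRing A]
    [Ring.KrullDimLE 1 A] {f : A} (hf : f ≠ 0) : {Q : Ideal A | Q.IsPrime ∧ f ∈ Q}.Finite := by
  refine ((Ideal.span {f}).finite_minimalPrimes_of_isNoetherianRing A).subset ?_
  rintro Q ⟨hQ, hfQ⟩
  refine ⟨⟨hQ, by simpa [Ideal.span_le] using hfQ⟩, ?_⟩
  rintro Q' ⟨hQ', hfQ'⟩ hle
  have hne : Q' ≠ ⊥ := by
    rintro rfl
    exact hf (by simpa using hfQ')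
  exact ((hQ'.isMaximal_of_ne_bot hne).eq_of_le hQ.ne_top hle).ge

/-- A curve that is not contained in a face meets it in finitely many closed points. -/
theorem Curve.finite_multiplicityAt {n : ℕ} (C : Curve k (n + 1)) (i : Fin (n + 1)) (c : k)
    (h : coordU k i - MvPolynomial.C c ∉ C.ideal) :
    {ξ : MaximalSpectrum (CoordRing k n) | multiplicityAt (C.faceIdeal i c) ξ ≠ 0}.Finite := by
  have hdim : Ring.KrullDimLE 1 (CoordRing k (n + 1) ⧸ C.ideal) :=
    Ring.krullDimLE_iff.2 (by rw [C.krullDim_eq_one]; rfl)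
  have hfin := finite_primes_of_mem
    (f := Ideal.Quotient.mk C.ideal (coordU k i - MvPolynomial.C c))
    (by rwa [Ne, Ideal.Quotient.eq_zero_iff_mem])
  have hfin2 := hfin.image (Ideal.comap (Ideal.Quotient.mk C.ideal))
  refine Set.Finite.of_finite_image (f := fun ξ => Ideal.comap (facePullback k i c) ξ.asIdeal)
    (hfin2.subset ?_) ?_
  · rintro _ ⟨ξ, hξ, rfl⟩
    have hle : C.faceIdeal i c ≤ ξ.asIdeal := by
      by_contra hcon
      apply hξ
      obtain ⟨a, haJ, haξ⟩ := SetLike.not_le_iff_exists.1 hcon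
      have htop : (C.faceIdeal i c).map
          (algebraMap (CoordRing k n) (Localization.AtPrime ξ.asIdeal)) = ⊤ :=
        Ideal.eq_top_of_isUnit_mem _ (Ideal.mem_map_of_mem _ haJ)
          (IsLocalization.map_units (M := ξ.asIdeal.primeCompl) _ ⟨a, haξ⟩)
      have : Subsingleton (Localization.AtPrime ξ.asIdeal ⧸ (C.faceIdeal i c).map
          (algebraMap (CoordRing k n) (Localization.AtPrime ξ.asIdeal))) :=
        Ideal.Quotient.subsingleton_iff.2 htop
      rw [multiplicityAt, Module.length_eq_zero, ENat.toNat_zero]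
    have hC : C.ideal ≤ Ideal.comap (facePullback k i c) ξ.asIdeal := Ideal.map_le_iff_le_comap.1 hle
    have hcm : (Ideal.map (Ideal.Quotient.mk C.ideal)
        (Ideal.comap (facePullback k i c) ξ.asIdeal)).comap (Ideal.Quotient.mk C.ideal) =
        Ideal.comap (facePullback k i c) ξ.asIdeal := by
      rw [Ideal.comap_map_of_surjective' _ Ideal.Quotient.mk_surjective, Ideal.mk_ker]
      exact sup_eq_left.2 hC
    refine ⟨Ideal.map (Ideal.Quotient.mk C.ideal)
      (Ideal.comap (facePullback k i c) ξ.asIdeal), ⟨?_, ?_⟩, hcm⟩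
    · exact Ideal.map_isPrime_of_surjective Ideal.Quotient.mk_surjective (by rwa [Ideal.mk_ker])
    · refine Ideal.mem_map_of_mem _ ?_
      rw [Ideal.mem_comap, facePullback_coordU]
      exact ξ.asIdeal.zero_mem
  · intro ξ _ ξ' _ hh
    exact MaximalSpectrum.ext
      (Ideal.comap_injective_of_surjective _ (facePullback_surjective i c) hh)

/-- The intersection cycle of `C ⊆ X_{n+1}` with the face `u_i = c`, as a `0`-cycle on `X_n`. (For
admissible `C` and `c = 0, 1` all the points of the intersection lie off `x = 0` and off the faces, so
that nothing is lost by listing only the multiplicities of such points.) -/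
def Curve.faceCycle {n : ℕ} (C : Curve k (n + 1)) (i : Fin (n + 1)) (c : k)
    (h : coordU k i - MvPolynomial.C c ∉ C.ideal) : ZeroCycles k n :=
  Finsupp.ofSupportFinite (fun ξ : OpenPoint k n => (multiplicityAt (C.faceIdeal i c) ξ.1 : ℤ))
    (Set.Finite.of_finite_image (f := Subtype.val)
      ((C.finite_multiplicityAt i c h).subset (by
        rintro _ ⟨ξ, hξ, rfl⟩
        simpa using hξ))
      Subtype.val_injective.injOn)

/-- `∂_i^0 C`, the intersection with the face `y_i = 0`. -/
def AdmissibleCurve.faceZero {n : ℕ} (C : AdmissibleCurve k n) (i : Fin (n + 1)) : ZeroCycles k n :=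
  C.toCurve.faceCycle i 0 (by simpa using C.zero_notMem i)

/-- `∂_i^∞ C`, the intersection with the face `y_i = ∞`. -/
def AdmissibleCurve.faceInfty {n : ℕ} (C : AdmissibleCurve k n) (i : Fin (n + 1)) : ZeroCycles k n :=
  C.toCurve.faceCycle i 1 (by simpa using C.infty_notMem i)

variable (k) in
/-- The boundary `∂ = ∑_{i=1}^{n+1} (-1)^i (∂_i^0 - ∂_i^∞) : 𝓩₁(X_{n+1}) → 𝓩₀(X_n)`. The index `i`
starts at `0` in the code, hence the exponent `i + 1`. -/
def boundary (n : ℕ) : OneCycles k n →+ ZeroCycles k n :=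
  Finsupp.liftAddHom fun C =>
    zmultiplesHom (ZeroCycles k n)
      (∑ i : Fin (n + 1), (-1 : ℤ) ^ ((i : ℕ) + 1) • (C.faceZero i - C.faceInfty i))

variable (k) in
/-- The additive Chow group `TH k m = 𝓩₀(X_m) / ∂ 𝓩₁(X_{m+1})`, that is, `TH_M^n(k, n)` for
`n = m + 1`. -/
abbrev TH (m : ℕ) : Type _ := ZeroCycles k m ⧸ (boundary k m).range

/-- The `k`-rational point of `X_n` with coordinates `x = a` and `u_i = v i`. -/
def rationalPoint {n : ℕ} (a : k) (v : Fin n → k) : MaximalSpectrum (CoordRing k n) :=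
  ⟨RingHom.ker (MvPolynomial.aeval (fun o : Option (Fin n) => o.elim a v) : CoordRing k n →ₐ[k] k),
    RingHom.ker_isMaximal_of_surjective _ fun c => ⟨MvPolynomial.C c, by simp⟩⟩

theorem isOffBoundary_rationalPoint {n : ℕ} {a : k} {b : Fin n → kˣ} (ha : a ≠ 0)
    (hb : ∀ i, (b i : k) ≠ 1) :
    IsOffBoundary (rationalPoint a⁻¹ fun i => (b i : k) / ((b i : k) - 1)) := by
  refine ⟨by simpa [rationalPoint, coordX, RingHom.mem_ker] using ha, fun i => ?_⟩
  have h1 : (b i : k) - 1 ≠ 0 := sub_ne_zero.2 (hb i)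
  refine ⟨by simpa [rationalPoint, coordU, RingHom.mem_ker] using h1, ?_⟩
  have h2 : (b i : k) / ((b i : k) - 1) - 1 ≠ 0 := by
    rw [div_sub_one h1]
    exact div_ne_zero (by simp) h1
  simpa [rationalPoint, coordU, RingHom.mem_ker] using h2

open Classical in
/-- The class in `TH_M^{m+1}(k, m+1)` of the `k`-rational point `(x, y_1, …, y_m) =
(1/a, b_1, …, b_m)`. It is `0` by convention if `a = 0`, or if some `b_i` is `1` (there is no such
point on `X_m`, as `1` is removed from `ℙ¹`). -/
def pointClass {m : ℕ} (a : k) (b : Fin m → kˣ) : TH k m :=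
  if h : a ≠ 0 ∧ ∀ i, (b i : k) ≠ 1 then
    QuotientAddGroup.mk (Finsupp.single
      (⟨rationalPoint a⁻¹ fun i => (b i : k) / ((b i : k) - 1),
        isOffBoundary_rationalPoint h.1 h.2⟩ : OpenPoint k m) 1)
  else 0

end Cycles

section Differentials

variable (k : Type*) [Field k]

/-- `b ↦ db / b`, from `k^×` to the absolute Kähler differentials. -/
def dlogUnit : Additive kˣ →+ Ω[k⁄ℤ] where
  toFun b := ((b.toMul⁻¹ : kˣ) : k) • KaehlerDifferential.D ℤ k (b.toMul : k)
  map_zero' := by simp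
  map_add' a b := by
    have ha : (a.toMul : k) ≠ 0 := a.toMul.ne_zero
    have hb : (b.toMul : k) ≠ 0 := b.toMul.ne_zero
    simp only [toMul_add, Units.val_inv_eq_inv_val, Units.val_mul, Derivation.leibniz, smul_add,
      smul_smul]
    rw [add_comm]
    congr 2 <;> field_simp

/-- `(b_1, …, b_m) ↦ db_1/b_1 ∧ … ∧ db_m/b_m`, as an alternating map over `ℤ`. -/
def dlogAlternating (m : ℕ) : Additive kˣ [⋀^Fin m]→ₗ[ℤ] ⋀[k]^m Ω[k⁄ℤ] :=
  AlternatingMap.compLinearMap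
    { (exteriorPower.ιMulti k m (M := Ω[k⁄ℤ])).toMultilinearMap.restrictScalars ℤ with
      map_eq_zero_of_eq' := (exteriorPower.ιMulti k m (M := Ω[k⁄ℤ])).map_eq_zero_of_eq' }
    (dlogUnit k).toIntLinearMap

/-- The map `k ⊗ ⋀^m k^× → Ω^m_k`, `a ⊗ (b_1 ∧ … ∧ b_m) ↦ a db_1/b_1 ∧ … ∧ db_m/b_m`. -/
def dlog (m : ℕ) : k ⊗[ℤ] (⋀[ℤ]^m (Additive kˣ)) →ₗ[k] ⋀[k]^m Ω[k⁄ℤ] :=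
  LinearMap.liftBaseChange k (exteriorPower.alternatingMapLinearEquiv (dlogAlternating k m))

end Differentials

end AdditiveChow

end

/-! Every relation needed in `TH` is the boundary of an explicit rational curve all of whose zeros
and poles are rational points. `sum_pointCycle_eq_zero` turns such a parametrised curve into a
relation; the intersection multiplicities come from `localLength_comap_span_prod`.

With x = s and y = (s - p)(s - p') / (p p' - (p + p') s) one has y - 1 = s² / (p p' - (p + p') s),
exactly the vanishing at x = 0 that modulus 2 asks for. The zeros p, p' and the pole p p' / (p + p')
of y give additivity in a (`pointClass_add`). On curves with constant x the modulus condition is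
empty, and the curves known from Milnor K-theory give multiplicativity in each b_i
(`pointClass_update_mul`) and the Steinberg relation (`pointClass_steinberg`). As a can be halved, a
symbol with an entry -1 vanishes, so the symbol is alternating (`pointClass_eq_zero_of_eq`). Hence Φ
exists.

When 2 is invertible, a homomorphism on k ⊗ ⋀^m k^× factors through Ω^m as soon as it respects α
dlog α + β dlog β = (α + β) dlog (α + β) in each slot, with arbitrary coefficients
(`exists_comp_dlog_eq`). So it remains to see that D_c(α) = [cα; α, w] is additive in α. Adding the
coordinate 1 - s/e to the first curve gives `pointClass_lin_quad`. For suitable p, p', e this says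
that the deviation E_c(β, α) = D_c(α + β) - D_c(α) - D_c(β) is additive in α away from degenerate
positions (`deviation_pointClass`).

The rest is algebra (`additive_of_deviation`). First 3 E_c(β, β) = 0, and replacing c by c/3 gives
E_c(β, β) = 0; this extends additivity to the degenerate positions. Now E_c is symmetric and
biadditive, so E_c(-β, -α) = E_c(β, α), while D_c is odd, so E_c(-β, -α) = -E_c(β, α). Thus 2 E_c =
0, and replacing c by c/2 gives E_c = 0. -/

noncomputable section

namespace AdditiveChow

/-! ### Lengths of local rings of a quotient. -/

section LocalLength

variable {B : Type*} [CommRing B]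

/-- The length of the local ring of `B ⧸ J` at the prime `P`. -/
def localLength (J P : Ideal B) [P.IsPrime] : ℕ∞ :=
  Module.length (Localization.AtPrime P)
    (Localization.AtPrime P ⧸ J.map (algebraMap B (Localization.AtPrime P)))

theorem localLength_eq_zero_iff (J P : Ideal B) [P.IsPrime] : localLength J P = 0 ↔ ¬ J ≤ P := by
  rw [localLength, Module.length_eq_zero_iff, Ideal.Quotient.subsingleton_iff, ← not_iff_not, ← Ne,
    not_not, IsLocalization.map_algebraMap_ne_top_iff_disjoint P.primeCompl, Set.disjoint_left]
  exact ⟨fun h x hx => not_not.1 fun hP => h hP hx, fun h x hx hJ => hx (h hJ)⟩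

theorem localLength_self (P : Ideal B) [P.IsMaximal] : localLength P P = 1 := by
  rw [localLength, Module.length_eq_one_iff, Localization.AtPrime.map_eq_maximalIdeal]
  exact isSimpleModule_iff_isCoatom.2 (IsLocalRing.maximalIdeal.isMaximal _).out

theorem localLength_of_isMaximal (J P : Ideal B) [J.IsMaximal] [P.IsMaximal] [Decidable (J = P)] :
    localLength J P = if J = P then 1 else 0 := by
  split_ifs with h
  · subst h
    exact localLength_self J
  · rw [localLength_eq_zero_iff]
    exact fun hle => h (Ideal.IsMaximal.eq_of_le ‹_› (Ideal.IsMaximal.ne_top ‹_›) hle)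

/-- Additivity of the length along `0 → B ⧸ (J : b) → B ⧸ J → B ⧸ (J + b) → 0`. -/
theorem localLength_eq_add (J J₁ J₂ P : Ideal B) [P.IsPrime] (b : B)
    (h₁ : J₁ = J ⊔ Ideal.span {b}) (h₂ : ∀ c, c ∈ J₂ ↔ b * c ∈ J) :
    localLength J P = localLength J₂ P + localLength J₁ P := by
  set R := Localization.AtPrime P
  set g := algebraMap B R
  have hle : J.map g ≤ J₁.map g := Ideal.map_mono (h₁ ▸ le_sup_left)
  have hmem : ∀ z : R, z ∈ J₂.map g ↔ g b * z ∈ J.map g := by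
    intro z
    obtain ⟨c, t, rfl⟩ := IsLocalization.exists_mk'_eq P.primeCompl z
    rw [IsLocalization.mul_mk'_eq_mk'_of_mul, IsLocalization.mk'_mem_map_algebraMap_iff,
      IsLocalization.mk'_mem_map_algebraMap_iff]
    refine exists_congr fun s => and_congr_right fun _ => ?_
    rw [h₂, mul_left_comm]
  let f₁ : (R ⧸ J₂.map g) →ₗ[R] (R ⧸ J.map g) :=
    Submodule.mapQ _ _ (LinearMap.mulLeft R (g b)) fun z hz => (hmem z).1 hz
  let f₂ : (R ⧸ J.map g) →ₗ[R] (R ⧸ J₁.map g) := Submodule.factor hle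
  refine Module.length_eq_add_of_exact f₁ f₂ ?_ (Submodule.factor_surjective hle) ?_
  · rw [← LinearMap.ker_eq_bot, LinearMap.ker_eq_bot']
    intro z
    obtain ⟨z, rfl⟩ := Submodule.Quotient.mk_surjective _ z
    intro hz
    replace hz : (Submodule.Quotient.mk (g b * z) : R ⧸ J.map g) = 0 := hz
    rw [Submodule.Quotient.mk_eq_zero] at hz
    exact (Submodule.Quotient.mk_eq_zero _).2 ((hmem z).2 hz)
  · intro z
    obtain ⟨z, rfl⟩ := Submodule.Quotient.mk_surjective _ z
    change (Submodule.Quotient.mk z : R ⧸ J₁.map g) = 0 ↔ _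
    rw [Submodule.Quotient.mk_eq_zero, h₁, Ideal.map_sup, Ideal.map_span,
      Set.image_singleton, Submodule.mem_sup]
    constructor
    · rintro ⟨y, hy, w, hw, rfl⟩
      obtain ⟨v, rfl⟩ := Ideal.mem_span_singleton.1 hw
      refine ⟨Submodule.Quotient.mk v, ?_⟩
      change (Submodule.Quotient.mk (g b * v) : R ⧸ J.map g) = _
      rw [Submodule.Quotient.eq]
      simpa using neg_mem hy
    · rintro ⟨w, hw⟩
      obtain ⟨w, rfl⟩ := Submodule.Quotient.mk_surjective _ w
      replace hw : (Submodule.Quotient.mk (g b * w) : R ⧸ J.map g) = _ := hw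
      rw [Submodule.Quotient.eq] at hw
      exact ⟨_, neg_mem hw, _, Ideal.mem_span_singleton.2 ⟨w, rfl⟩, by simp⟩

end LocalLength

/-! ### Length of the pullback of a product of prime elements. -/

section Pullback

variable {B S : Type*} [CommRing B] [CommRing S] [IsDomain S] (ρ : B →+* S)

/-- Length of the pullback of the ideal of a product of prime elements, along a ring homomorphism
that is surjective modulo this product. -/
theorem localLength_comap_span_prod {ι : Type*} (l : ι → S)
    (L : Multiset ι) (hne : ∀ r ∈ L, l r ≠ 0)
    (hmax : ∀ r ∈ L, ((Ideal.span {l r}).comap ρ).IsMaximal) (P : Ideal B) [P.IsMaximal]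
    [∀ J : Ideal B, Decidable (J = P)] (f : S) (hf : Associated f (L.map l).prod)
    (hsurj : ∀ z : S, ∃ b : B, z - ρ b ∈ Ideal.span {f}) :
    localLength ((Ideal.span {f}).comap ρ) P =
      ((L.map fun r => if (Ideal.span {l r}).comap ρ = P then 1 else 0).sum : ℕ) := by
  rw [Ideal.span_singleton_eq_span_singleton.2 hf] at hsurj ⊢
  clear hf
  induction L using Multiset.induction with
  | empty =>
    have hP := Ideal.IsPrime.ne_top (I := P) inferInstance
    simpa [localLength_eq_zero_iff] using hP
  | cons r L ih =>
    simp only [Multiset.map_cons, Multiset.prod_cons, Multiset.sum_cons] at hsurj ⊢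
    have hr := hne r (Multiset.mem_cons_self r L)
    have hm := hmax r (Multiset.mem_cons_self r L)
    set p := (L.map l).prod
    have h1 : Ideal.span {l r * p} ≤ Ideal.span {l r} :=
      Ideal.span_singleton_le_span_singleton.2 (dvd_mul_right _ _)
    have h2 : Ideal.span {l r * p} ≤ Ideal.span {p} :=
      Ideal.span_singleton_le_span_singleton.2 (dvd_mul_left _ _)
    -- `ρ` need not hit the prime factor itself. A lift `b` modulo the whole product is enough:
    -- adding `b` to the pulled back ideal gives the pullback of the factor, and the colon ideal by
    -- `b` is the pullback of the remaining product.
    obtain ⟨b, hb⟩ := hsurj (l r)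
    rw [localLength_eq_add _ ((Ideal.span {l r}).comap ρ) ((Ideal.span {p}).comap ρ) P b,
      localLength_of_isMaximal ((Ideal.span {l r}).comap ρ) P,
      ih (fun r hr => hne r (Multiset.mem_cons_of_mem hr))
        (fun r hr => hmax r (Multiset.mem_cons_of_mem hr))
        (fun z => (hsurj z).imp fun _ h => h2 h), add_comm]
    · push_cast
      rfl
    · apply le_antisymm
      · intro c hc
        obtain ⟨h, hh⟩ := Ideal.mem_span_singleton.1 hc
        obtain ⟨h', hh'⟩ := hsurj h
        have : c - b * h' ∈ (Ideal.span {l r * p}).comap ρ := by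
          have e : ρ (c - b * h') = l r * (h - ρ h') + (l r - ρ b) * ρ h' := by
            rw [map_sub, map_mul, hh]; ring
          rw [Ideal.mem_comap, e]
          exact add_mem (Ideal.mul_mem_left _ _ hh') (Ideal.mul_mem_right _ _ hb)
        rw [← sub_add_cancel c (b * h')]
        exact Submodule.add_mem_sup this (Ideal.mul_mem_right _ _ (Ideal.mem_span_singleton_self b))
      · refine sup_le (Ideal.comap_mono h1) ((Ideal.span_singleton_le_iff_mem _).2 ?_)
        rw [Ideal.mem_comap, ← sub_sub_cancel (l r) (ρ b)]
        exact sub_mem (Ideal.mem_span_singleton_self _) (h1 hb)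
    · intro c
      rw [Ideal.mem_comap, Ideal.mem_comap, map_mul]
      have : ρ b * ρ c = l r * ρ c - (l r - ρ b) * ρ c := by ring
      rw [this, Submodule.sub_mem_iff_left _ (Ideal.mul_mem_right _ _ hb), Ideal.mem_span_singleton,
        Ideal.mem_span_singleton, mul_dvd_mul_iff_left hr]

end Pullback

/-! ### Curves parametrised by an open part of the affine line, and their intersections with faces.
-/

section ParamRing

variable {k : Type*} [Field k]

/-- The coordinate ring of the affine line minus the zeros of `q`. -/
abbrev ParamRing (q : Polynomial k) : Type _ := Localization.Away q

/-- The rational points of the affine line minus the zeros of `q`. -/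
abbrev ParamPoint (q : Polynomial k) : Type _ := {r : k // q.eval r ≠ 0}

namespace ParamRing

variable {q : Polynomial k}

variable (q) in
/-- A polynomial as a function on the complement of the zeros of `q`. -/
def ofPoly : Polynomial k →ₐ[k] ParamRing q := IsScalarTower.toAlgHom k _ _

theorem ofPoly_apply (p : Polynomial k) : ofPoly q p = algebraMap _ (ParamRing q) p := rfl

theorem ofPoly_injective (hq : q ≠ 0) : Function.Injective (ofPoly q) :=
  IsLocalization.injective _ (powers_le_nonZeroDivisors_of_noZeroDivisors hq)

theorem isDomain (hq : q ≠ 0) : IsDomain (ParamRing q) :=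
  IsLocalization.isDomain_localization (powers_le_nonZeroDivisors_of_noZeroDivisors hq)

/-- Evaluation at a point. -/
def eval (r : ParamPoint q) : ParamRing q →ₐ[k] k :=
  IsLocalization.liftAlgHom (M := Submonoid.powers q) (f := Polynomial.aeval r.1) (by
    rintro ⟨_, n, rfl⟩
    simpa [Polynomial.aeval_def] using fun h => absurd h r.2)

@[simp]
theorem eval_ofPoly (r : ParamPoint q) (p : Polynomial k) :
    eval r (ofPoly q p) = p.eval r.1 := by
  rw [eval, IsLocalization.liftAlgHom_apply, ofPoly_apply, IsLocalization.lift_eq]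
  simp

/-- The function `s - r`. -/
def linear (r : ParamPoint q) : ParamRing q := ofPoly q (Polynomial.X - Polynomial.C r.1)

theorem linear_ne_zero (hq : q ≠ 0) (r : ParamPoint q) : linear r ≠ 0 := by
  rw [linear, Ne, map_eq_zero_iff _ (ofPoly_injective hq)]
  exact Polynomial.X_sub_C_ne_zero _

theorem span_linear (r : ParamPoint q) :
    Ideal.span {linear r} = RingHom.ker (eval r) := by
  refine le_antisymm ?_ fun z hz => ?_
  · rw [Ideal.span_singleton_le_iff_mem, RingHom.mem_ker, linear, eval_ofPoly]
    simp
  · obtain ⟨p, t, rfl⟩ := IsLocalization.exists_mk'_eq (Submonoid.powers q) z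
    rw [Ideal.mem_span_singleton]
    have h1 : eval r (ofPoly q p) = 0 := by
      rw [ofPoly_apply, ← IsLocalization.mk'_spec (ParamRing q) p t, map_mul,
        (RingHom.mem_ker).1 hz, zero_mul]
    rw [eval_ofPoly] at h1
    obtain ⟨p', rfl⟩ := Polynomial.dvd_iff_isRoot.2 h1
    rw [← IsLocalization.mul_mk'_eq_mk'_of_mul]
    exact dvd_mul_right _ _

/-- A principal ideal domain has dimension one unless it is a field. The rational point excludes a
field, because the nonzero function s - r generates the kernel of evaluation there. -/
theorem ringKrullDim_eq_one (r : ParamPoint q) : ringKrullDim (ParamRing q) = 1 := by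
  have hq : q ≠ 0 := by
    rintro rfl
    exact r.2 (by simp)
  have := isDomain hq
  have : IsPrincipalIdealRing (ParamRing q) := ⟨fun I => by
    rw [← IsLocalization.map_under (Submonoid.powers q) _ I]
    exact Submodule.IsPrincipal.map_ringHom _ (IsPrincipalIdealRing.principal _)⟩
  refine IsPrincipalIdealRing.ringKrullDim_eq_one _ fun hF => linear_ne_zero hq r ?_
  have hm : (RingHom.ker (eval r)).IsMaximal :=
    RingHom.ker_isMaximal_of_surjective _ fun c => ⟨algebraMap _ _ c, by simp⟩
  let := hF.toField
  have := (Ideal.eq_bot_or_top (RingHom.ker (eval r))).resolve_right hm.ne_top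
  rwa [← span_linear, Ideal.span_singleton_eq_bot] at this

end ParamRing

/-- The morphism to `X_n` with coordinate functions `x` and `u_i`. -/
def paramHom {S : Type*} [CommRing S] [Algebra k S] {n : ℕ} (x : S) (u : Fin n → S) :
    CoordRing k n →ₐ[k] S :=
  MvPolynomial.aeval fun o => o.elim x u

section paramHom

variable {S : Type*} [CommRing S] [Algebra k S] {n : ℕ} (x : S)

@[simp]
theorem paramHom_coordX (u : Fin n → S) : paramHom x u (coordX k n) = x := by
  simp [paramHom, coordX]

@[simp]
theorem paramHom_coordU (u : Fin n → S) (i : Fin n) : paramHom x u (coordU k i) = u i := by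
  simp [paramHom, coordU]

@[simp]
theorem facePullback_coordX (i : Fin (n + 1)) (c : k) :
    facePullback k i c (coordX k (n + 1)) = coordX k n := by
  rw [coordX, facePullback, MvPolynomial.aeval_X]
  rfl

@[simp]
theorem facePullback_coordU_self (i : Fin (n + 1)) (c : k) :
    facePullback k i c (coordU k i) = algebraMap k _ c := by
  rw [coordU, facePullback, MvPolynomial.aeval_X]
  exact Fin.insertNth_apply_same ..

@[simp]
theorem facePullback_coordU_succAbove (i : Fin (n + 1)) (c : k) (j : Fin n) :
    facePullback k i c (coordU k (i.succAbove j)) = coordU k j := by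
  rw [coordU, facePullback, MvPolynomial.aeval_X]
  exact Fin.insertNth_apply_succAbove (α := fun _ => CoordRing k n) ..

/-- Both homomorphisms agree on generators modulo u_i - c. In consequence, if the full coordinate
map is surjective, then the one with u_i omitted is still surjective modulo u_i - c, as the length
formula requires. -/
theorem paramHom_sub_facePullback_mem (u : Fin (n + 1) → S) (i : Fin (n + 1)) (c : k)
    (z : CoordRing k (n + 1)) :
    paramHom x u z - paramHom x (fun j => u (i.succAbove j)) (facePullback k i c z) ∈
      Ideal.span {u i - algebraMap k S c} := by
  set I := Ideal.span {u i - algebraMap k S c}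
  have : (Ideal.Quotient.mkₐ k I).comp (paramHom x u) = (Ideal.Quotient.mkₐ k I).comp
      ((paramHom x fun j => u (i.succAbove j)).comp (facePullback k i c)) := by
    refine MvPolynomial.algHom_ext fun o => ?_
    cases o with
    | none =>
      rw [← coordX.eq_def]
      simp
    | some j =>
      rw [← coordU.eq_def]
      obtain rfl | ⟨j, rfl⟩ := Fin.eq_self_or_eq_succAbove i j
      · have : Ideal.Quotient.mk I (u j) = Ideal.Quotient.mk I (algebraMap k S c) :=
          Ideal.Quotient.eq.2 (Ideal.mem_span_singleton_self _)
        simp only [AlgHom.comp_apply, facePullback_coordU_self, AlgHom.commutes, paramHom_coordU]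
        exact this
      · simp
  exact Ideal.Quotient.eq.1 (DFunLike.congr_fun this z)

/-- For the harder inclusion: if z restricts to (u_i - c) h on the curve, surjectivity lifts h to
the ambient space, and subtracting the corresponding multiple of the equation of the face gives a
function that vanishes on the curve and has the same restriction to the face as z. -/
theorem map_ker_facePullback (u : Fin (n + 1) → S) (hu : Function.Surjective (paramHom (k := k) x u))
    (i : Fin (n + 1)) (c : k) :
    (RingHom.ker (paramHom (k := k) x u)).map (facePullback k i c) =
      (Ideal.span {u i - algebraMap k S c}).comap
        (paramHom (k := k) x fun j => u (i.succAbove j)) := by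
  refine le_antisymm (Ideal.map_le_iff_le_comap.2 fun z hz => ?_) fun b hb => ?_
  · have := paramHom_sub_facePullback_mem x u i c z
    rwa [(RingHom.mem_ker).1 hz, zero_sub, neg_mem_iff] at this
  · obtain ⟨z, rfl⟩ := facePullback_surjective i c b
    have hz : paramHom x u z ∈ Ideal.span {u i - algebraMap k S c} := by
      have := add_mem (paramHom_sub_facePullback_mem x u i c z) (Ideal.mem_comap.1 hb)
      rwa [sub_add_cancel] at this
    obtain ⟨h, hh⟩ := Ideal.mem_span_singleton.1 hz
    obtain ⟨h, rfl⟩ := hu h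
    have hk : z - (coordU k i - MvPolynomial.C c) * h ∈ RingHom.ker (paramHom (k := k) x u) := by
      rw [RingHom.mem_ker, map_sub, hh, map_mul, map_sub, paramHom_coordU,
        ← MvPolynomial.algebraMap_eq, AlgHom.commutes, sub_self]
    have := Ideal.mem_map_of_mem (facePullback k i c) hk
    rwa [map_sub, map_mul, facePullback_coordU, zero_mul, sub_zero] at this

end paramHom

open ParamRing

variable {q : Polynomial k} {n : ℕ}

/-- The curve in `X_n` parametrised by `x` and `u_i`, when these functions generate `ParamRing q`. -/
def paramCurve (r : ParamPoint q) (x : ParamRing q) (u : Fin n → ParamRing q)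
    (hu : Function.Surjective (paramHom (k := k) x u)) : Curve k n where
  ideal := RingHom.ker (paramHom (k := k) x u)
  isPrime := by
    have := isDomain (q := q) (by
      rintro rfl
      exact r.2 (by simp))
    exact RingHom.ker_isPrime _
  krullDim_eq_one := by
    exact (ringKrullDim_eq_of_ringEquiv (RingHom.quotientKerEquivOfSurjective
      (f := (paramHom (k := k) x u).toRingHom) hu)).trans (ringKrullDim_eq_one r)

theorem comap_span_linear (x : ParamRing q) (u : Fin n → ParamRing q) (r : ParamPoint q) :
    (Ideal.span {linear r}).comap (paramHom (k := k) x u) =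
      (rationalPoint (eval r x) fun j => eval r (u j)).asIdeal := by
  have : (eval r).comp (paramHom (k := k) x u) =
      MvPolynomial.aeval (fun o : Option (Fin n) => o.elim (eval r x) fun j => eval r (u j)) := by
    refine MvPolynomial.algHom_ext fun o => ?_
    cases o <;> simp [paramHom]
  change _ = RingHom.ker (MvPolynomial.aeval (R := k) _)
  rw [span_linear, ← this]
  rfl

theorem faceIdeal_paramCurve (r : ParamPoint q) (x : ParamRing q) (u : Fin (n + 1) → ParamRing q)
    (hu : Function.Surjective (paramHom (k := k) x u)) (i : Fin (n + 1)) (c : k) :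
    (paramCurve r x u hu).faceIdeal i c = (Ideal.span {u i - algebraMap k _ c}).comap
        (paramHom (k := k) x fun j => u (i.succAbove j)) :=
  map_ker_facePullback x u hu i c

-- Each factor s - r of u_i - c pulls back to the maximal ideal of a rational point of the face, so
-- the length at `ξ` counts, with multiplicity, the parameters mapped to `ξ`.
open Classical in
theorem localLength_faceIdeal (r : ParamPoint q) (x : ParamRing q) (u : Fin (n + 1) → ParamRing q)
    (hu : Function.Surjective (paramHom (k := k) x u)) (i : Fin (n + 1)) (c : k)
    (L : Multiset (ParamPoint q))
    (hL : Associated (u i - algebraMap k _ c) (L.map linear).prod)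
    (ξ : MaximalSpectrum (CoordRing k n)) :
    localLength ((paramCurve r x u hu).faceIdeal i c) ξ.asIdeal =
      ((L.map fun r => if (rationalPoint (eval r x) fun j => eval r (u (i.succAbove j))) = ξ
        then 1 else 0).sum : ℕ) := by
  have hq : q ≠ 0 := by
    rintro rfl
    exact r.2 (by simp)
  have := isDomain hq
  rw [faceIdeal_paramCurve, ← Ideal.comap_coe,
    localLength_comap_span_prod (S := ParamRing q) _ linear L (fun r _ => linear_ne_zero hq r)
      (fun r _ => ?_) ξ.asIdeal _ hL fun z => ?_]
  · simp only [Ideal.comap_coe, comap_span_linear, MaximalSpectrum.ext_iff]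
  · rw [Ideal.comap_coe, comap_span_linear]
    exact MaximalSpectrum.isMaximal _
  · obtain ⟨z, rfl⟩ := hu z
    exact ⟨_, paramHom_sub_facePullback_mem x u i c z⟩

open Classical in
/-- The `0`-cycle of a rational point, or `0` if the point lies on the boundary. -/
def pointCycle (a : k) (v : Fin n → k) : ZeroCycles k n :=
  if h : IsOffBoundary (rationalPoint a v) then Finsupp.single ⟨_, h⟩ 1 else 0

theorem isOffBoundary_rationalPoint_iff (a : k) (v : Fin n → k) :
    IsOffBoundary (rationalPoint a v) ↔ a ≠ 0 ∧ ∀ i, v i ≠ 0 ∧ v i ≠ 1 := by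
  simp [IsOffBoundary, rationalPoint, coordX, coordU, RingHom.mem_ker, sub_eq_zero]

theorem pointClass_eq_mk_pointCycle {a : k} {b : Fin n → kˣ} (ha : a ≠ 0)
    (hb : ∀ i, (b i : k) ≠ 1) :
    pointClass a b = QuotientAddGroup.mk (pointCycle a⁻¹ fun i => (b i : k) / ((b i : k) - 1)) := by
  rw [pointClass, dif_pos ⟨ha, hb⟩, pointCycle, dif_pos]

theorem faceCycle_paramCurve (r : ParamPoint q) (x : ParamRing q) (u : Fin (n + 1) → ParamRing q)
    (hu : Function.Surjective (paramHom (k := k) x u)) (i : Fin (n + 1)) (c : k)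
    (L : Multiset (ParamPoint q))
    (hL : Associated (u i - algebraMap k _ c) (L.map linear).prod) (h)
    (hoff : ∀ r ∈ L, eval r x ≠ 0 ∧ ∀ j, eval r (u (i.succAbove j)) ≠ 0 ∧
      eval r (u (i.succAbove j)) ≠ 1) :
    (paramCurve r x u hu).faceCycle i c h =
      (L.map fun r => pointCycle (eval r x) fun j => eval r (u (i.succAbove j))).sum := by
  classical
  ext ξ
  have h1 : (paramCurve r x u hu).faceCycle i c h ξ =
      ((localLength ((paramCurve r x u hu).faceIdeal i c) ξ.1.asIdeal).toNat : ℤ) := rfl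
  rw [h1, localLength_faceIdeal r x u hu i c L hL, ENat.toNat_natCast, ← Finsupp.applyAddHom_apply,
    map_multiset_sum, Nat.cast_multiset_sum, Multiset.map_map, Multiset.map_map]
  refine congrArg _ (Multiset.map_congr rfl fun r hr => ?_)
  have hr' := (isOffBoundary_rationalPoint_iff _ _).2 (hoff r hr)
  simp [pointCycle, dif_pos hr', Finsupp.single_apply, Subtype.ext_iff]

theorem eq_rationalPoint_of_faceIdeal_le (r : ParamPoint q) (x : ParamRing q)
    (u : Fin (n + 1) → ParamRing q)
    (hu : Function.Surjective (paramHom (k := k) x u)) (i : Fin (n + 1)) (c : k)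
    (L : Multiset (ParamPoint q))
    (hL : Associated (u i - algebraMap k _ c) (L.map linear).prod)
    (ξ : MaximalSpectrum (CoordRing k n))
    (hξ : (paramCurve r x u hu).faceIdeal i c ≤ ξ.asIdeal) :
    ∃ r ∈ L, (rationalPoint (eval r x) fun j => eval r (u (i.succAbove j))) = ξ := by
  classical
  by_contra! hcon
  refine (localLength_eq_zero_iff _ ξ.asIdeal).1 ?_ hξ
  rw [localLength_faceIdeal r x u hu i c L hL, Multiset.map_congr rfl fun r hr => if_neg (hcon r hr)]
  simp

/-- The relation in `TH` given by a parametrised curve. -/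
theorem sum_pointCycle_eq_zero (r : ParamPoint q) (x : ParamRing q) (u : Fin (n + 1) → ParamRing q)
    (hu : Function.Surjective (paramHom (k := k) x u)) (hx : x ≠ 0)
    (L₀ L₁ : Fin (n + 1) → Multiset (ParamPoint q))
    (h₀ : ∀ i, Associated (u i) ((L₀ i).map linear).prod)
    (h₁ : ∀ i, Associated (u i - 1) ((L₁ i).map linear).prod)
    (hoff : ∀ i, ∀ r ∈ L₀ i + L₁ i, eval r x ≠ 0 ∧ ∀ j, eval r (u (i.succAbove j)) ≠ 0 ∧
      eval r (u (i.succAbove j)) ≠ 1)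
    (hmod : (paramCurve r x u hu).HasModulusTwo) :
    ∑ i : Fin (n + 1), (-1 : ℤ) ^ ((i : ℕ) + 1) •
      (((L₀ i).map fun r => (QuotientAddGroup.mk
          (pointCycle (eval r x) fun j => eval r (u (i.succAbove j))) : TH k n)).sum -
        ((L₁ i).map fun r => (QuotientAddGroup.mk
          (pointCycle (eval r x) fun j => eval r (u (i.succAbove j))) : TH k n)).sum) = 0 := by
  have hq : q ≠ 0 := by
    rintro rfl
    exact r.2 (by simp)
  have := isDomain hq
  have hne : ∀ L : Multiset (ParamPoint q), (L.map linear).prod ≠ 0 := by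
    intro L h
    obtain ⟨r, -, hr⟩ := Multiset.mem_map.1 (Multiset.prod_eq_zero_iff.1 h)
    exact linear_ne_zero hq r hr
  have h₀' : ∀ i, Associated (u i - algebraMap k _ 0) ((L₀ i).map linear).prod := by simpa using h₀
  have h₁' : ∀ i, Associated (u i - algebraMap k _ 1) ((L₁ i).map linear).prod := by simpa using h₁
  let C : AdmissibleCurve k n :=
    { toCurve := paramCurve r x u hu
      x_notMem := by
        change ¬ paramHom x u _ = 0
        simpa using hx
      zero_notMem := fun i => by
        change ¬ paramHom x u _ = 0
        rw [paramHom_coordU]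
        exact fun h => hne _ ((h₀ i).eq_zero_iff.1 h)
      infty_notMem := fun i => by
        change ¬ paramHom x u _ = 0
        rw [map_sub, paramHom_coordU, map_one]
        exact fun h => hne _ ((h₁ i).eq_zero_iff.1 h)
      goodPosition_zero := fun i ξ hξ => by
        obtain ⟨r, hr, rfl⟩ := eq_rationalPoint_of_faceIdeal_le _ _ _ _ _ _ _ (h₀' i) _ hξ
        exact (isOffBoundary_rationalPoint_iff _ _).2
          (hoff i r (Multiset.mem_add.2 (Or.inl hr)))
      goodPosition_infty := fun i ξ hξ => by
        obtain ⟨r, hr, rfl⟩ := eq_rationalPoint_of_faceIdeal_le _ _ _ _ _ _ _ (h₁' i) _ hξ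
        exact (isOffBoundary_rationalPoint_iff _ _).2
          (hoff i r (Multiset.mem_add.2 (Or.inr hr)))
      modulus := hmod }
  have h0 : (QuotientAddGroup.mk (boundary k n (Finsupp.single C 1)) : TH k n) = 0 :=
    (QuotientAddGroup.eq_zero_iff _).2 ⟨_, rfl⟩
  rw [← h0, boundary, Finsupp.liftAddHom_apply_single, zmultiplesHom_apply, one_smul]
  have hz : ∀ i, C.faceZero i = _ := fun i => faceCycle_paramCurve r x u hu i 0 _ (h₀' i) _
    fun r hr => hoff i r (Multiset.mem_add.2 (Or.inl hr))
  have hi : ∀ i, C.faceInfty i = _ := fun i => faceCycle_paramCurve r x u hu i 1 _ (h₁' i) _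
    fun r hr => hoff i r (Multiset.mem_add.2 (Or.inr hr))
  simp only [hz, hi]
  rw [← QuotientAddGroup.mk'_apply, map_sum]
  refine Finset.sum_congr rfl fun i _ => ?_
  rw [map_zsmul, map_sub, map_multiset_sum, map_multiset_sum, Multiset.map_map, Multiset.map_map]
  rfl

end ParamRing

/-! ### The modulus condition for parametrised curves. -/

section Modulus

variable {k : Type*} [Field k]

/-- Nonzero constants have valuation 1 because they and their inverses lie in `V`. The polynomial is
its nonzero constant term plus a multiple of t, which is strictly smaller. -/
theorem valuation_aeval_eq_one {K : Type*} [Field K] [Algebra k K] (V : ValuationSubring K)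
    (hV : ∀ a : k, algebraMap k K a ∈ V) {t : K} (ht : V.valuation t < 1) {p : Polynomial k}
    (hp : p.eval 0 ≠ 0) : V.valuation (Polynomial.aeval t p) = 1 := by
  have hc : ∀ a : k, a ≠ 0 → V.valuation (algebraMap k K a) = 1 := by
    intro a ha
    refine le_antisymm ((V.valuation_le_one_iff _).2 (hV a)) ?_
    have := (V.valuation_le_one_iff _).2 (hV a⁻¹)
    rw [map_inv₀, map_inv₀] at this
    exact (inv_le_one₀ (zero_lt_iff.2 ((map_ne_zero _).2
      ((map_ne_zero _).2 ha)))).1 this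
  have htV : t ∈ V := (V.valuation_le_one_iff _).1 ht.le
  have hr : Polynomial.aeval t p.divX ∈ V := by
    rw [Polynomial.aeval_eq_sum_range]
    exact sum_mem fun i _ => by
      rw [Algebra.smul_def]
      exact mul_mem (hV _) (pow_mem htV i)
  rw [← Polynomial.divX_mul_X_add p, map_add, map_mul, Polynomial.aeval_X, Polynomial.aeval_C,
    Valuation.map_add_eq_of_lt_right]
  · exact hc (p.coeff 0) (by rwa [Polynomial.coeff_zero_eq_eval_zero])
  · rw [hc _ (by rwa [Polynomial.coeff_zero_eq_eval_zero]), map_mul]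
    exact mul_lt_one_of_nonneg_of_lt_one_right ((V.valuation_le_one_iff _).2 hr) zero_le ht

open ParamRing

variable {q : Polynomial k} {n : ℕ} (r : ParamPoint q)

/-- The inclusion of `ParamRing q` into the function field of a parametrised curve. -/
def toFunctionField (x : ParamRing q) (u : Fin n → ParamRing q)
    (hu : Function.Surjective (paramHom (k := k) x u)) :
    ParamRing q →ₐ[k] (paramCurve r x u hu).FunctionField :=
  (IsScalarTower.toAlgHom k (CoordRing k n ⧸ (paramCurve r x u hu).ideal)
    (paramCurve r x u hu).FunctionField).comp
    (Ideal.quotientKerAlgEquivOfSurjective hu).symm.toAlgHom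

theorem toFunctionField_paramHom (x : ParamRing q) (u : Fin n → ParamRing q)
    (hu : Function.Surjective (paramHom (k := k) x u)) (z : CoordRing k n) :
    toFunctionField r x u hu (paramHom x u z) = (paramCurve r x u hu).restrict z := by
  have : (Ideal.quotientKerAlgEquivOfSurjective hu).symm (paramHom x u z) =
      Ideal.Quotient.mk (RingHom.ker (paramHom (k := k) x u)) z := by
    rw [AlgEquiv.symm_apply_eq]
    rfl
  exact congrArg (algebraMap (CoordRing k n ⧸ (paramCurve r x u hu).ideal)
    (paramCurve r x u hu).FunctionField) this

theorem toFunctionField_injective (x : ParamRing q) (u : Fin n → ParamRing q)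
    (hu : Function.Surjective (paramHom (k := k) x u)) :
    Function.Injective (toFunctionField r x u hu) := by
  exact (IsFractionRing.injective (CoordRing k n ⧸ (paramCurve r x u hu).ideal)
    (paramCurve r x u hu).FunctionField).comp
      (AlgEquiv.injective (Ideal.quotientKerAlgEquivOfSurjective hu).symm)

theorem x_paramCurve (x : ParamRing q) (u : Fin n → ParamRing q)
    (hu : Function.Surjective (paramHom (k := k) x u)) :
    (paramCurve r x u hu).x = toFunctionField r x u hu x := by
  rw [Curve.x, ← toFunctionField_paramHom, paramHom_coordX]

theorem y_paramCurve (x : ParamRing q) (u : Fin n → ParamRing q)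
    (hu : Function.Surjective (paramHom (k := k) x u)) (i : Fin n) :
    (paramCurve r x u hu).y i =
      toFunctionField r x u hu (u i) / (toFunctionField r x u hu (u i) - 1) := by
  rw [Curve.y, ← toFunctionField_paramHom, ← toFunctionField_paramHom, map_sub, paramHom_coordU,
    map_sub, map_one, map_one]

/-- A curve with constant `x ≠ 0` satisfies the modulus condition. -/
theorem hasModulusTwo_of_const {a : k} (ha : a ≠ 0) (u : Fin n → ParamRing q)
    (hu : Function.Surjective (paramHom (k := k) (algebraMap k (ParamRing q) a) u)) :
    (paramCurve r _ u hu).HasModulusTwo := by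
  intro V hV hx
  rw [x_paramCurve, AlgHom.commutes] at hx
  -- No place lies over x = 0: the inverse of the constant x is integral as well, contradicting
  -- `hx`.
  have := (V.valuation_le_one_iff _).2 (hV a⁻¹)
  rw [map_inv₀, map_inv₀, inv_le_one₀ (zero_lt_iff.2 ((map_ne_zero _).2
      ((map_ne_zero _).2 ha)))] at this
  exact absurd hx this.not_gt

/-- A curve parametrised by `x` satisfies the modulus condition if the `y_j` are invertible at
`x = 0` and some `y_i - 1` vanishes there to order two. -/
theorem hasModulusTwo_of_param (u : Fin n → ParamRing q)
    (hu : Function.Surjective (paramHom (k := k) (ofPoly q Polynomial.X) u))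
    (num den : Fin n → Polynomial k) (hnum : ∀ j, (num j).eval 0 ≠ 0)
    (hden : ∀ j, (den j).eval 0 ≠ 0)
    (hy : ∀ j, ofPoly q (den j) * u j = ofPoly q (num j) * (u j - 1))
    (i : Fin n) (c : Polynomial k) (hc : c.eval 0 ≠ 0)
    (hi : (u i - 1) * ofPoly q (Polynomial.X ^ 2 * c) = ofPoly q (den i)) :
    (paramCurve r _ u hu).HasModulusTwo := by
  intro V hV hx
  set τ := toFunctionField r _ u hu
  have hτ : ∀ p, τ (ofPoly q p) = Polynomial.aeval (τ (ofPoly q Polynomial.X)) p := by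
    intro p
    rw [← AlgHom.comp_apply, ← AlgHom.comp_apply, Polynomial.aeval_algHom_apply,
      Polynomial.aeval_X_left_apply]
  rw [x_paramCurve] at hx ⊢
  have hv : ∀ p : Polynomial k, p.eval 0 ≠ 0 → V.valuation (τ (ofPoly q p)) = 1 := fun p hp => by
    rw [hτ]
    exact valuation_aeval_eq_one V hV hx hp
  have hq : q ≠ 0 := by
    rintro rfl
    exact r.2 (by simp)
  have hne : ∀ j, u j ≠ 1 := fun j h => by
    have h1 := hy j
    rw [h, sub_self, mul_zero, mul_one, map_eq_zero_iff _ (ofPoly_injective hq)] at h1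
    exact hden j (by rw [h1, Polynomial.eval_zero])
  have hne' : ∀ j, τ (u j) - 1 ≠ 0 := fun j h => hne j
    (toFunctionField_injective r _ u hu (by rw [map_one]; exact sub_eq_zero.1 h))
  have hyv : ∀ j, V.valuation ((paramCurve r _ u hu).y j) = 1 := by
    intro j
    have h := congrArg (fun z => V.valuation (τ z)) (hy j)
    simp only [map_mul, hv _ (hnum j), hv _ (hden j), one_mul, map_sub τ, map_one τ] at h
    rw [y_paramCurve, map_div₀, h, div_self]
    exact (map_ne_zero _).2 (hne' j)
  refine ⟨i, ?_⟩
  simp only [hyv, inv_one, min_self, Finset.prod_const_one, mul_one]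
  -- Since u - 1 = 1 / (y - 1), the hypothesis `hi` says y_i - 1 = x² c / den_i, where c and den_i
  -- are units at this place.
  have h := congrArg (fun z => V.valuation (τ z)) hi
  simp only [map_mul, hv _ hc, hv _ (hden i), map_sub τ, map_one τ, map_pow, mul_one] at h
  rw [y_paramCurve, div_sub_one (hne' i), sub_sub_cancel, map_div₀, map_one]
  rw [one_div]
  exact (inv_eq_of_mul_eq_one_right h).le

end Modulus

/-! ### Tools for reading off relations, and additivity in the first entry. -/

section Relations

variable {k : Type*} [Field k]

namespace ParamRing

variable (q : Polynomial k)

/-- The coordinate function. -/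
def coord : ParamRing q := ofPoly q Polynomial.X

/-- The inverse of `q`. -/
def inv : ParamRing q := IsLocalization.Away.invSelf q

variable {q}

@[simp]
theorem ofPoly_X : ofPoly q Polynomial.X = coord q := rfl

@[simp]
theorem ofPoly_C (c : k) : ofPoly q (Polynomial.C c) = algebraMap k _ c := (ofPoly q).commutes c

theorem ofPoly_mul_inv : ofPoly q q * inv q = 1 := IsLocalization.Away.mul_invSelf q

@[simp]
theorem eval_coord (r : ParamPoint q) : eval r (coord q) = r.1 := by
  rw [← ofPoly_X, eval_ofPoly, Polynomial.eval_X]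

@[simp]
theorem eval_inv (r : ParamPoint q) : eval r (inv q) = (q.eval r.1)⁻¹ := by
  have := congrArg (eval r) (ofPoly_mul_inv (q := q))
  rw [map_mul, eval_ofPoly, map_one] at this
  exact eq_inv_of_mul_eq_one_right this

theorem linear_eq (r : ParamPoint q) : linear r = coord q - algebraMap k _ r.1 := by
  rw [linear, map_sub, ofPoly_X, ofPoly_C]

theorem coord_ne_zero (r : ParamPoint q) : coord q ≠ 0 := by
  have hq : q ≠ 0 := by
    rintro rfl
    exact r.2 (by simp)
  rw [← ofPoly_X, Ne, map_eq_zero_iff _ (ofPoly_injective hq)]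
  exact Polynomial.X_ne_zero

theorem isUnit_algebraMap {c : k} (hc : c ≠ 0) : IsUnit (algebraMap k (ParamRing q) c) :=
  hc.isUnit.map _

/-- This is how the parametrised curves are seen to be closed in X_n: the coordinates have to
generate both s and 1/q. -/
theorem eq_top_of_coord_mem (R : Subalgebra k (ParamRing q)) (hc : coord q ∈ R)
    (hi : inv q ∈ R) : R = ⊤ := by
  refine eq_top_iff.2 fun z _ => ?_
  obtain ⟨p, ⟨_, n, rfl⟩, rfl⟩ := IsLocalization.exists_mk'_eq (Submonoid.powers q) z
  have h1 : ofPoly q p ∈ R := by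
    have : (ofPoly q p) = Polynomial.aeval (coord q) p := by
      rw [← ofPoly_X, Polynomial.aeval_algHom_apply, Polynomial.aeval_X_left_apply]
    rw [this]
    exact Algebra.adjoin_le (Set.singleton_subset_iff.2 hc)
      (Polynomial.aeval_mem_adjoin_singleton k (coord q))
  have h2 : IsLocalization.mk' (ParamRing q) p (⟨_, n, rfl⟩ : Submonoid.powers q) =
      ofPoly q p * inv q ^ n := by
    rw [IsLocalization.mk'_eq_iff_eq_mul]
    change ofPoly q p = ofPoly q p * inv q ^ n * ofPoly q (q ^ n)
    rw [map_pow, mul_assoc, ← mul_pow, mul_comm (inv q), ofPoly_mul_inv, one_pow, mul_one]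
  rw [h2]
  exact mul_mem h1 (pow_mem hi n)

end ParamRing

open ParamRing

variable {q : Polynomial k} {n : ℕ}

theorem mem_range_paramHom_x {S : Type*} [CommRing S] [Algebra k S] (x : S) (u : Fin n → S) :
    x ∈ (paramHom (k := k) x u).range := ⟨_, paramHom_coordX x u⟩

theorem mem_range_paramHom_u {S : Type*} [CommRing S] [Algebra k S] (x : S) (u : Fin n → S)
    (i : Fin n) : u i ∈ (paramHom (k := k) x u).range := ⟨_, paramHom_coordU x u i⟩

theorem paramHom_surjective (x : ParamRing q) (u : Fin n → ParamRing q)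
    (hc : coord q ∈ (paramHom (k := k) x u).range) (hi : inv q ∈ (paramHom (k := k) x u).range) :
    Function.Surjective (paramHom (k := k) x u) :=
  (AlgHom.range_eq_top _).1 (eq_top_of_coord_mem _ hc hi)

/-- The coordinate `u = y / (y - 1)`. -/
def toU (y : k) : k := y / (y - 1)

theorem toU_ne_zero {y : kˣ} (hy : (y : k) ≠ 1) : toU (y : k) ≠ 0 :=
  div_ne_zero y.ne_zero (sub_ne_zero.2 hy)

theorem toU_sub_one {y : k} (hy : y ≠ 1) : toU y - 1 = (y - 1)⁻¹ := by
  rw [toU, div_sub_one (sub_ne_zero.2 hy), sub_sub_cancel, one_div]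

theorem toU_sub_one_ne_zero {y : k} (hy : y ≠ 1) : toU y - 1 ≠ 0 := by
  rw [toU_sub_one hy]
  exact inv_ne_zero (sub_ne_zero.2 hy)

theorem mul_toU_sub_one {y : k} (hy : y ≠ 1) : y * (toU y - 1) = toU y := by
  rw [toU_sub_one hy, toU, div_eq_mul_inv]

/-- The parametrised point at `r` has coordinates `x = 1/a` and `y = b`. -/
def HasCoords (r : ParamPoint q) (x : ParamRing q) (v : Fin n → ParamRing q) (a : k)
    (b : Fin n → kˣ) : Prop :=
  a ≠ 0 ∧ eval r x = a⁻¹ ∧ ∀ j, (b j : k) ≠ 1 ∧ eval r (v j) = toU (b j : k)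

theorem HasCoords.off {r : ParamPoint q} {x : ParamRing q} {v : Fin n → ParamRing q} {a : k}
    {b : Fin n → kˣ} (h : HasCoords r x v a b) :
    eval r x ≠ 0 ∧ ∀ j, eval r (v j) ≠ 0 ∧ eval r (v j) ≠ 1 := by
  obtain ⟨ha, hx, hb⟩ := h
  refine ⟨hx ▸ inv_ne_zero ha, fun j => ?_⟩
  rw [(hb j).2]
  exact ⟨toU_ne_zero (hb j).1, fun h => toU_sub_one_ne_zero (hb j).1 (sub_eq_zero.2 h)⟩

theorem HasCoords.mk_pointCycle {r : ParamPoint q} {x : ParamRing q} {v : Fin n → ParamRing q}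
    {a : k} {b : Fin n → kˣ} (h : HasCoords r x v a b) :
    (QuotientAddGroup.mk (pointCycle (eval r x) fun j => eval r (v j)) : TH k n) =
      pointClass a b := by
  obtain ⟨ha, hx, hb⟩ := h
  rw [pointClass_eq_mk_pointCycle ha fun j => (hb j).1, hx, funext fun j => (hb j).2]
  rfl

theorem pointClass_eq_zero_of_eq_one (a : k) {b : Fin n → kˣ} (j : Fin n) (hj : (b j : k) = 1) :
    pointClass a b = 0 := by
  rw [pointClass, dif_neg]
  exact fun h => h.2 j hj

@[simp]
theorem pointClass_zero (b : Fin n → kˣ) : pointClass (0 : k) b = 0 := by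
  rw [pointClass, dif_neg]
  exact fun h => h.1 rfl

/-- A constant coordinate. -/
def constU (q : Polynomial k) (y : kˣ) : ParamRing q := algebraMap k _ (toU (y : k))

theorem associated_constU {y : kˣ} (hy : (y : k) ≠ 1) :
    Associated (constU q y) ((0 : Multiset (ParamPoint q)).map linear).prod := by
  rw [Multiset.map_zero, Multiset.prod_zero, associated_one_iff_isUnit]
  exact isUnit_algebraMap (toU_ne_zero hy)

theorem associated_constU_sub_one {y : kˣ} (hy : (y : k) ≠ 1) :
    Associated (constU q y - 1) ((0 : Multiset (ParamPoint q)).map linear).prod := by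
  rw [Multiset.map_zero, Multiset.prod_zero, associated_one_iff_isUnit, constU,
    ← map_one (algebraMap k (ParamRing q)), ← map_sub]
  exact isUnit_algebraMap (toU_sub_one_ne_zero hy)

theorem associated_zero {f : ParamRing q} (hf : IsUnit f) :
    Associated f ((0 : Multiset (ParamPoint q)).map linear).prod := by
  rwa [Multiset.map_zero, Multiset.prod_zero, associated_one_iff_isUnit]

theorem associated_singleton (r : ParamPoint q) {f g : ParamRing q} (hg : IsUnit g)
    (h : f = (coord q - algebraMap k _ r.1) * g) :
    Associated f (({r} : Multiset (ParamPoint q)).map linear).prod := by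
  rw [Multiset.map_singleton, Multiset.prod_singleton, linear_eq, h]
  exact associated_mul_unit_left _ _ hg

theorem associated_pair (r r' : ParamPoint q) {f g : ParamRing q} (hg : IsUnit g)
    (h : f = (coord q - algebraMap k _ r.1) * (coord q - algebraMap k _ r'.1) * g) :
    Associated f (({r, r'} : Multiset (ParamPoint q)).map linear).prod := by
  rw [Multiset.insert_eq_cons, Multiset.map_cons, Multiset.prod_cons, Multiset.map_singleton,
    Multiset.prod_singleton, linear_eq, linear_eq, h]
  exact associated_mul_unit_left _ _ hg

section PunctureZero

theorem coord_mul_inv : coord (Polynomial.X : Polynomial k) * inv Polynomial.X = 1 :=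
  ofPoly_mul_inv

theorem isUnit_inv : IsUnit (inv q) := IsUnit.of_mul_eq_one _ ((mul_comm _ _).trans ofPoly_mul_inv)

/-- A nonzero point. -/
def nonzeroPoint (p : k) (hp : p ≠ 0) : ParamPoint (Polynomial.X : Polynomial k) :=
  ⟨p, by rwa [Polynomial.eval_X]⟩

/-- The function `u = y / (y - 1)` for `y = (s - p) (s - p') / (p p' - (p + p') s)`. -/
def quadU (p p' : k) : ParamRing (Polynomial.X : Polynomial k) :=
  (coord _ - algebraMap k _ p) * (coord _ - algebraMap k _ p') * inv _ ^ 2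

theorem quadU_sub_one (p p' : k) : quadU p p' - 1 =
    (algebraMap k _ (p * p') - algebraMap k _ (p + p') * coord _) * inv _ ^ 2 := by
  have := coord_mul_inv (k := k)
  rw [quadU, map_mul, map_add]
  linear_combination (coord Polynomial.X * inv Polynomial.X + 1) * this

/-- The pole of `(s - p) (s - p') / (p p' - (p + p') s)` away from infinity. -/
def polePoints (p p' : k) (hp : p ≠ 0) (hp' : p' ≠ 0) :
    Multiset (ParamPoint (Polynomial.X : Polynomial k)) :=
  open Classical in
  if h : p + p' = 0 then 0 else {nonzeroPoint (p * p' / (p + p')) (div_ne_zero (mul_ne_zero hp hp') h)}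

theorem associated_quadU {p p' : k} (hp : p ≠ 0) (hp' : p' ≠ 0) : Associated (quadU p p')
    (({nonzeroPoint p hp, nonzeroPoint p' hp'} : Multiset (ParamPoint _)).map linear).prod :=
  associated_pair _ _ (isUnit_inv.pow 2) rfl

theorem associated_quadU_sub_one {p p' : k} (hp : p ≠ 0) (hp' : p' ≠ 0) :
    Associated (quadU p p' - 1) ((polePoints p p' hp hp').map linear).prod := by
  rw [quadU_sub_one, polePoints]
  split_ifs with h
  · apply associated_zero
    rw [h, map_zero, zero_mul, sub_zero]
    exact (isUnit_algebraMap (mul_ne_zero hp hp')).mul (isUnit_inv.pow 2)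
  · refine associated_singleton _ (g := algebraMap k _ (-(p + p')) * inv _ ^ 2)
      ((isUnit_algebraMap (neg_ne_zero.2 h)).mul (isUnit_inv.pow 2)) ?_
    have : algebraMap k (ParamRing (Polynomial.X : Polynomial k)) (p * p') =
        algebraMap k _ (p + p') * algebraMap k _ (p * p' / (p + p')) := by
      rw [← map_mul, mul_div_cancel₀ _ h]
    rw [map_neg, this, nonzeroPoint]
    ring

/-- From u - 1 = (p p' - (p + p') s) / s² one gets s (u - 1) + (p + p') = p p' / s. -/
theorem inv_mem_of_quadU_mem {p p' : k} (hp : p ≠ 0) (hp' : p' ≠ 0)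
    (R : Subalgebra k (ParamRing (Polynomial.X : Polynomial k))) (hc : coord _ ∈ R)
    (hu : quadU p p' ∈ R) : inv _ ∈ R := by
  have h1 : inv (Polynomial.X : Polynomial k) = algebraMap k _ (p * p')⁻¹ *
      (coord _ * (quadU p p' - 1) + algebraMap k _ (p + p')) := by
    have h2 : algebraMap k (ParamRing (Polynomial.X : Polynomial k)) (p * p')⁻¹ *
        algebraMap k _ (p * p') = 1 := by
      rw [← map_mul, inv_mul_cancel₀ (mul_ne_zero hp hp'), map_one]
    have := coord_mul_inv (k := k)
    rw [quadU_sub_one]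
    linear_combination (-inv Polynomial.X) * h2 -
      (algebraMap k _ (p * p')⁻¹ * algebraMap k _ (p * p') * inv Polynomial.X -
        algebraMap k _ (p * p')⁻¹ * algebraMap k _ (p + p') * (coord _ * inv Polynomial.X + 1)) * this
  rw [h1]
  exact mul_mem (R.algebraMap_mem _)
    (add_mem (mul_mem hc (sub_mem hu (one_mem R))) (R.algebraMap_mem _))

theorem den_mul_quadU (p p' : k) :
    ofPoly _ (Polynomial.C (p * p') - Polynomial.C (p + p') * Polynomial.X) * quadU p p' =
      ofPoly _ ((Polynomial.X - Polynomial.C p) * (Polynomial.X - Polynomial.C p')) *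
        (quadU p p' - 1) := by
  rw [quadU_sub_one, quadU]
  simp only [map_sub, map_mul, ofPoly_C, ofPoly_X]
  ring

theorem quadU_sub_one_mul (p p' : k) :
    (quadU p p' - 1) * ofPoly _ (Polynomial.X ^ 2 * 1) =
      ofPoly _ (Polynomial.C (p * p') - Polynomial.C (p + p') * Polynomial.X) := by
  have : coord (Polynomial.X : Polynomial k) ^ 2 * inv _ ^ 2 = 1 := by
    rw [← mul_pow, coord_mul_inv, one_pow]
  rw [quadU_sub_one]
  simp only [mul_one, map_sub, map_mul, map_pow, ofPoly_C, ofPoly_X]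
  linear_combination (algebraMap k (ParamRing (Polynomial.X : Polynomial k)) p *
    algebraMap k _ p' - algebraMap k _ (p + p') * coord Polynomial.X) * this

theorem den_mul_constU {y : kˣ} (hy : (y : k) ≠ 1) :
    ofPoly q 1 * constU q y = ofPoly q (Polynomial.C (y : k)) * (constU q y - 1) := by
  rw [map_one, one_mul, ofPoly_C, constU, ← map_one (algebraMap k (ParamRing q)), ← map_sub,
    ← map_mul, mul_toU_sub_one hy]

/-- The pole p p' / (p + p') is the inverse of 1/p + 1/p'. If p + p' = 0 there is no finite pole,
and the right side vanishes by the convention for first entry 0. -/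
theorem sum_polePoints {p p' : k} (hp : p ≠ 0) (hp' : p' ≠ 0) (b : k → Fin n → kˣ) :
    ((polePoints p p' hp hp').map fun r => pointClass r.1⁻¹ (b r.1)).sum =
      pointClass (p⁻¹ + p'⁻¹) (b (p * p' / (p + p'))) := by
  have h1 : p⁻¹ + p'⁻¹ = (p * p' / (p + p'))⁻¹ := by
    rw [inv_div, inv_add_inv hp hp']
  rw [h1, polePoints]
  split_ifs with h
  · simp [h]
  · rw [Multiset.map_singleton, Multiset.sum_singleton]
    rfl

/-- The curve is x = s, y_1 = (s - p)(s - p') / (p p' - (p + p') s), with the other coordinates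
constant. It is punctured at s = 0 because y_1 = 1 there. Only the faces of y_1 contribute: the two
zeros against the pole. -/
theorem pointClass_inv_add_inv {p p' : k} (hp : p ≠ 0) (hp' : p' ≠ 0) (w : Fin n → kˣ) :
    pointClass (p⁻¹ + p'⁻¹) w = pointClass p⁻¹ w + pointClass p'⁻¹ w := by
  by_cases hw : ∀ j, (w j : k) ≠ 1
  swap
  · push Not at hw
    obtain ⟨j, hj⟩ := hw
    simp only [pointClass_eq_zero_of_eq_one _ j hj, add_zero]
  set u : Fin (n + 1) → ParamRing (Polynomial.X : Polynomial k) :=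
    Fin.cons (quadU p p') fun j => constU _ (w j) with hu
  have hs : Function.Surjective (paramHom (k := k) (coord Polynomial.X) u) := by
    have hc := mem_range_paramHom_x (k := k) (coord Polynomial.X) u
    exact paramHom_surjective _ _ hc (inv_mem_of_quadU_mem hp hp' _ hc
      (mem_range_paramHom_u (k := k) (coord Polynomial.X) u 0))
  have H : ∀ r : ParamPoint (Polynomial.X : Polynomial k),
      HasCoords r (coord _) (fun j => u (Fin.succAbove 0 j)) r.1⁻¹ w := fun r =>
    ⟨inv_ne_zero (by simpa using r.2), by simp, fun j => ⟨hw j, by simp [hu, constU]⟩⟩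
  have key := sum_pointCycle_eq_zero (nonzeroPoint p hp) (coord _) u hs
    (coord_ne_zero (nonzeroPoint p hp))
    (Fin.cons {nonzeroPoint p hp, nonzeroPoint p' hp'} fun _ => 0)
    (Fin.cons (polePoints p p' hp hp') fun _ => 0)
    (Fin.forall_fin_succ.2 ⟨associated_quadU hp hp', fun j => associated_constU (hw j)⟩)
    (Fin.forall_fin_succ.2 ⟨associated_quadU_sub_one hp hp', fun j =>
      associated_constU_sub_one (hw j)⟩)
    (Fin.forall_fin_succ.2 ⟨fun r _ => (H r).off, fun j r hr => by simp at hr⟩)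
    (hasModulusTwo_of_param _ u hs
      (Fin.cons ((Polynomial.X - Polynomial.C p) * (Polynomial.X - Polynomial.C p'))
        fun j => Polynomial.C (w j : k))
      (Fin.cons (Polynomial.C (p * p') - Polynomial.C (p + p') * Polynomial.X) fun _ => 1)
      (Fin.forall_fin_succ.2 ⟨by simp [hp, hp'], by simp⟩)
      (Fin.forall_fin_succ.2 ⟨by simp [hp, hp'], by simp⟩)
      (Fin.forall_fin_succ.2 ⟨den_mul_quadU p p', fun j => den_mul_constU (hw j)⟩) 0 1
      (by simp) (quadU_sub_one_mul p p'))
  rw [Fin.sum_univ_succ] at key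
  simp only [Fin.cons_zero, Fin.cons_succ, (H _).mk_pointCycle,
    sum_polePoints hp hp' fun _ => w] at key
  simp only [nonzeroPoint, Multiset.insert_eq_cons, Multiset.map_cons, Multiset.map_singleton,
    Multiset.sum_cons, Multiset.sum_singleton, Multiset.map_zero, Multiset.sum_zero, sub_self,
    smul_zero, Finset.sum_const_zero, add_zero, Fin.val_zero, zero_add, pow_one, neg_smul, one_smul,
    neg_eq_zero] at key
  exact (sub_eq_zero.1 key).symm

/-- Additivity in the first argument. -/
theorem pointClass_add (a a' : k) (w : Fin n → kˣ) :
    pointClass (a + a') w = pointClass a w + pointClass a' w := by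
  rcases eq_or_ne a 0 with rfl | ha
  · simp
  rcases eq_or_ne a' 0 with rfl | ha'
  · simp
  simpa using pointClass_inv_add_inv (inv_ne_zero ha) (inv_ne_zero ha') w

end PunctureZero
end Relations

/-! ### The four-term relation from a curve with two nonconstant y-coordinates and x = s. -/

section Relations

variable {k : Type*} [Field k]

open ParamRing

variable {n : ℕ}

open Classical in
/-- A nonzero element as a unit; `0` is sent to `1`. -/
def unitOf (z : k) : kˣ := if h : z = 0 then 1 else Units.mk0 z h

theorem coe_unitOf {z : k} (hz : z ≠ 0) : (unitOf z : k) = z := by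
  rw [unitOf, dif_neg hz, Units.val_mk0]

@[simp]
theorem unitOf_coe (z : kˣ) : unitOf (z : k) = z := Units.ext (coe_unitOf z.ne_zero)

theorem unitOf_mul {z z' : k} (hz : z ≠ 0) (hz' : z' ≠ 0) :
    unitOf (z * z') = unitOf z * unitOf z' := Units.ext <| by
  rw [Units.val_mul, coe_unitOf hz, coe_unitOf hz', coe_unitOf (mul_ne_zero hz hz')]

/-- The function `u = y / (y - 1)` for `y = 1 - s / e`. -/
def linU (e : k) : ParamRing (Polynomial.X : Polynomial k) :=
  (coord _ - algebraMap k _ e) * inv _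

theorem linU_sub_one (e : k) : linU e - 1 = algebraMap k _ (-e) * inv _ := by
  rw [linU, map_neg]
  linear_combination coord_mul_inv (k := k)

theorem den_mul_linU (e : k) : ofPoly _ (Polynomial.C (-e)) * linU e =
    ofPoly _ (Polynomial.X - Polynomial.C e) * (linU e - 1) := by
  rw [linU_sub_one, linU, map_sub, ofPoly_X, ofPoly_C, ofPoly_C]
  ring

theorem eval_linU (e : k) (he : e ≠ 0) (r : ParamPoint (Polynomial.X : Polynomial k))
    (hr : r.1 ≠ e) : (unitOf (1 - r.1 / e) : k) ≠ 1 ∧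
      eval r (linU e) = toU (unitOf (1 - r.1 / e) : k) := by
  have h0 : r.1 ≠ 0 := by simpa using r.2
  have h1 : 1 - r.1 / e ≠ 0 := by
    rw [one_sub_div he]
    exact div_ne_zero (sub_ne_zero.2 hr.symm) he
  rw [coe_unitOf h1]
  refine ⟨by simpa using ⟨h0, he⟩, ?_⟩
  simp only [linU, toU, map_mul, map_sub, eval_coord, eval_inv, AlgHom.commutes,
    Algebra.algebraMap_self, RingHom.id_apply, Polynomial.eval_X, sub_sub_cancel_left]
  field_simp
  ring

theorem eval_quadU {p p' e : k} (he : e ≠ 0) (h : p * p' - (p + p') * e ≠ 0) (hep : e ≠ p)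
    (hep' : e ≠ p') :
    (unitOf ((e - p) * (e - p') / (p * p' - (p + p') * e)) : k) ≠ 1 ∧
      eval (nonzeroPoint e he) (quadU p p') =
        toU (unitOf ((e - p) * (e - p') / (p * p' - (p + p') * e)) : k) := by
  have h1 := sub_ne_zero.2 hep
  have h2 := sub_ne_zero.2 hep'
  rw [coe_unitOf (div_ne_zero (mul_ne_zero h1 h2) h)]
  have h3 : (e - p) * (e - p') / (p * p' - (p + p') * e) - 1 =
      e ^ 2 / (p * p' - (p + p') * e) := by
    rw [div_sub_one h]
    ring
  refine ⟨fun hh => ?_, ?_⟩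
  · rw [← sub_eq_zero, h3] at hh
    exact div_ne_zero (pow_ne_zero 2 he) h hh
  · rw [toU, h3, div_div_div_cancel_right₀ h]
    simp [quadU, nonzeroPoint, div_eq_mul_inv]

/-- The curve is x = s, y_1 = 1 - s/e, y_2 = (s - p)(s - p') / (p p' - (p + p') s), with the other
coordinates constant. The face y_1 = 0 gives the point s = e, and the faces of y_2 give s = p, s =
p' and the pole of y_2. The three nonvanishing conditions keep these points off the other faces; the
modulus condition is supplied by y_2. -/
theorem pointClass_lin_quad {p p' e : k} (hp : p ≠ 0) (hp' : p' ≠ 0) (he : e ≠ 0)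
    (h : p * p' - (p + p') * e ≠ 0) (hep : e ≠ p) (hep' : e ≠ p') (w : Fin n → kˣ) :
    pointClass (p⁻¹ + p'⁻¹) (Fin.cons (unitOf (1 - p * p' / (p + p') / e)) w : Fin (n + 1) → kˣ) +
        pointClass e⁻¹ (Fin.cons (unitOf ((e - p) * (e - p') / (p * p' - (p + p') * e))) w :
          Fin (n + 1) → kˣ) =
      pointClass p⁻¹ (Fin.cons (unitOf (1 - p / e)) w : Fin (n + 1) → kˣ) +
        pointClass p'⁻¹ (Fin.cons (unitOf (1 - p' / e)) w : Fin (n + 1) → kˣ) := by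
  by_cases hw : ∀ j, (w j : k) ≠ 1
  swap
  · push Not at hw
    obtain ⟨j, hj⟩ := hw
    rw [pointClass_eq_zero_of_eq_one _ j.succ, pointClass_eq_zero_of_eq_one _ j.succ,
      pointClass_eq_zero_of_eq_one _ j.succ, pointClass_eq_zero_of_eq_one _ j.succ] <;>
    simpa using hj
  set u : Fin (n + 2) → ParamRing (Polynomial.X : Polynomial k) :=
    Fin.cons (linU e) (Fin.cons (quadU p p') fun j => constU _ (w j) :
      Fin (n + 1) → ParamRing (Polynomial.X : Polynomial k)) with hu
  have hs : Function.Surjective (paramHom (k := k) (coord Polynomial.X) u) := by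
    have hc := mem_range_paramHom_x (k := k) (coord Polynomial.X) u
    exact paramHom_surjective _ _ hc (inv_mem_of_quadU_mem hp hp' _ hc
      (mem_range_paramHom_u (k := k) (coord Polynomial.X) u 1))
  have H0 : HasCoords (nonzeroPoint e he) (coord _) (fun j => u (Fin.succAbove 0 j)) e⁻¹
      (Fin.cons (unitOf ((e - p) * (e - p') / (p * p' - (p + p') * e))) w : Fin (n + 1) → kˣ) :=
    ⟨inv_ne_zero he, by simp [nonzeroPoint], Fin.forall_fin_succ.2
      ⟨by simpa [hu] using eval_quadU he h hep hep', fun j => ⟨by simpa using hw j,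
        by simp [hu, constU]⟩⟩⟩
  have H1 : ∀ r : ParamPoint (Polynomial.X : Polynomial k), r.1 ≠ e →
      HasCoords r (coord _) (fun j => u (Fin.succAbove (Fin.succ 0) j)) r.1⁻¹
        (Fin.cons (unitOf (1 - r.1 / e)) w : Fin (n + 1) → kˣ) := fun r hr =>
    ⟨inv_ne_zero (by simpa using r.2), by simp, Fin.forall_fin_succ.2
      ⟨by simpa [hu] using eval_linU e he r hr, fun j => ⟨by simpa using hw j,
        by simp [hu, constU]⟩⟩⟩
  have hpole : ∀ r ∈ polePoints p p' hp hp', r.1 ≠ e := by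
    intro r hr
    rw [polePoints] at hr
    split_ifs at hr with h0
    · simp at hr
    · rw [Multiset.mem_singleton] at hr
      rw [hr, nonzeroPoint, Ne, div_eq_iff h0, mul_comm e]
      exact fun h' => h (sub_eq_zero.2 h')
  have key := sum_pointCycle_eq_zero (nonzeroPoint p hp) (coord _) u hs
    (coord_ne_zero (nonzeroPoint p hp))
    (Fin.cons {nonzeroPoint e he} (Fin.cons {nonzeroPoint p hp, nonzeroPoint p' hp'} fun _ => 0 :
      Fin (n + 1) → Multiset _))
    (Fin.cons 0 (Fin.cons (polePoints p p' hp hp') fun _ => 0 : Fin (n + 1) → Multiset _))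
    (Fin.forall_fin_succ.2 ⟨associated_singleton _ isUnit_inv rfl,
      Fin.forall_fin_succ.2 ⟨associated_quadU hp hp', fun j => associated_constU (hw j)⟩⟩)
    (Fin.forall_fin_succ.2 ⟨associated_zero (by
        rw [hu, Fin.cons_zero, linU_sub_one]
        exact (isUnit_algebraMap (neg_ne_zero.2 he)).mul isUnit_inv),
      Fin.forall_fin_succ.2 ⟨associated_quadU_sub_one hp hp', fun j =>
        associated_constU_sub_one (hw j)⟩⟩)
    (Fin.forall_fin_succ.2 ⟨fun r hr => by
        obtain rfl : r = nonzeroPoint e he := by simpa using hr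
        exact H0.off,
      Fin.forall_fin_succ.2 ⟨fun r hr => (H1 r (by
        rcases Multiset.mem_add.1 hr with hr | hr
        · obtain rfl | rfl : r = nonzeroPoint p hp ∨ r = nonzeroPoint p' hp' := by simpa using hr
          exacts [hep.symm, hep'.symm]
        · exact hpole r hr)).off, fun j r hr => by simp at hr⟩⟩)
    (hasModulusTwo_of_param _ u hs
      (Fin.cons (Polynomial.X - Polynomial.C e)
        (Fin.cons ((Polynomial.X - Polynomial.C p) * (Polynomial.X - Polynomial.C p'))
          fun j => Polynomial.C (w j : k) : Fin (n + 1) → Polynomial k))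
      (Fin.cons (Polynomial.C (-e)) (Fin.cons
        (Polynomial.C (p * p') - Polynomial.C (p + p') * Polynomial.X) fun _ => 1 :
          Fin (n + 1) → Polynomial k))
      (Fin.forall_fin_succ.2 ⟨by simp [he], Fin.forall_fin_succ.2 ⟨by simp [hp, hp'], by simp⟩⟩)
      (Fin.forall_fin_succ.2 ⟨by simp [he], Fin.forall_fin_succ.2 ⟨by simp [hp, hp'], by simp⟩⟩)
      (Fin.forall_fin_succ.2 ⟨den_mul_linU e,
        Fin.forall_fin_succ.2 ⟨den_mul_quadU p p', fun j => den_mul_constU (hw j)⟩⟩) 1 1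
      (by simp) (quadU_sub_one_mul p p'))
  rw [Fin.sum_univ_succ, Fin.sum_univ_succ, Fin.cons_zero, Fin.cons_zero, Fin.cons_succ,
    Fin.cons_zero, Fin.cons_succ, Fin.cons_zero,
    Multiset.map_congr (s := polePoints p p' hp hp') rfl fun r hr =>
      (H1 r (hpole r hr)).mk_pointCycle, sum_polePoints hp hp' fun r =>
        (Fin.cons (unitOf (1 - r / e)) w : Fin (n + 1) → kˣ)] at key
  simp only [Multiset.insert_eq_cons, Multiset.map_cons, Multiset.map_singleton,
    Multiset.sum_cons, Multiset.sum_singleton, H0.mk_pointCycle,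
    (H1 (nonzeroPoint p hp) hep.symm).mk_pointCycle,
    (H1 (nonzeroPoint p' hp') hep'.symm).mk_pointCycle] at key
  simp only [nonzeroPoint, Fin.cons_succ, Multiset.map_zero, Multiset.sum_zero, sub_self, sub_zero,
    smul_zero, Finset.sum_const_zero, add_zero, Fin.val_zero, zero_add, pow_one, neg_smul, one_smul,
    Fin.val_succ, Int.reduceNeg, Int.reducePow, Nat.reduceAdd] at key
  rw [eq_comm, ← sub_eq_zero, ← key]
  module

end Relations

/-! ### Multiplicativity in each of the b_i. -/

section Relations

variable {k : Type*} [Field k]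

open ParamRing

variable {n : ℕ}

/-- Index bookkeeping: two nonconstant coordinates will occupy adjacent places, and deleting either
must leave the other in slot `i` and all constants in the same slots. -/
theorem succ_succAbove_of_ne {i j : Fin n} (h : j ≠ i) :
    i.succ.succAbove j = i.castSucc.succAbove j := by
  rcases lt_or_gt_of_ne h with h | h
  · rw [Fin.succAbove_of_castSucc_lt _ _ (Fin.castSucc_lt_succ_iff.2 h.le),
      Fin.succAbove_of_castSucc_lt _ _ (by simpa using h)]
  · rw [Fin.succAbove_of_le_castSucc _ _ (Fin.succ_le_castSucc_iff.2 h),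
      Fin.succAbove_of_le_castSucc _ _ (by simpa using h.le)]

theorem succ_succAbove_self (i : Fin n) : i.succ.succAbove i = i.castSucc :=
  Fin.succAbove_of_castSucc_lt _ _ (Fin.castSucc_lt_succ_iff.2 le_rfl)

theorem algebraMap_ne_zero {q : Polynomial k} (r : ParamPoint q) {c : k} (hc : c ≠ 0) :
    algebraMap k (ParamRing q) c ≠ 0 := fun h => hc <| by
  exact ((eval r).commutes c).symm.trans (by rw [h, map_zero])

theorem one_sub_mul_toU {b : k} (hb : b ≠ 1) : (1 - b) * toU b = -b := by
  have := sub_ne_zero.2 hb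
  rw [toU]
  field_simp
  ring

/-- The function `u = y / (y - 1)` for `y = a (t - b) / (t - a b)`, where `s = t / (t - 1)`. -/
def mulU (a b : k) : ParamRing (Polynomial.X : Polynomial k) :=
  algebraMap k _ (toU a) * (algebraMap k _ (1 - b) * coord _ + algebraMap k _ b) * inv _

theorem mulU_eq {a b : k} (hb : b ≠ 1) : mulU a b =
    (coord _ - algebraMap k _ (toU b)) * (algebraMap k _ (toU a * (1 - b)) * inv _) := by
  have h : algebraMap k (ParamRing (Polynomial.X : Polynomial k)) b =
      - (algebraMap k _ (1 - b) * algebraMap k _ (toU b)) := by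
    rw [← map_mul, ← map_neg, one_sub_mul_toU hb, neg_neg]
  rw [mulU, map_mul]
  linear_combination (algebraMap k _ (toU a) * inv Polynomial.X) * h

theorem mulU_sub_one {a b : k} (ha : a ≠ 1) : mulU a b - 1 =
    algebraMap k _ (a - 1)⁻¹ * (algebraMap k _ (1 - a * b) * coord _ + algebraMap k _ (a * b)) *
      inv _ := by
  have h0 := sub_ne_zero.2 ha
  have h1 : algebraMap k (ParamRing (Polynomial.X : Polynomial k)) (toU a * (1 - b) - 1) =
      algebraMap k _ ((a - 1)⁻¹ * (1 - a * b)) := by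
    congr 1
    rw [toU]
    field_simp
    ring
  have h2 : algebraMap k (ParamRing (Polynomial.X : Polynomial k)) (toU a * b) =
      algebraMap k _ ((a - 1)⁻¹ * (a * b)) := by
    congr 1
    rw [toU]
    field_simp
  rw [map_sub, map_mul, map_mul _ (a - 1)⁻¹, map_one] at h1
  rw [map_mul, map_mul _ (a - 1)⁻¹] at h2
  rw [mulU]
  linear_combination (coord Polynomial.X * inv Polynomial.X) * h1 + inv Polynomial.X * h2 +
    coord_mul_inv (k := k)

/-- Here u = `toU a` · ((1 - b) + b/s), an affine function of 1/s that can be solved for 1/s. -/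
theorem inv_mem_of_mulU_mem {a b : kˣ} (ha : (a : k) ≠ 1)
    (R : Subalgebra k (ParamRing (Polynomial.X : Polynomial k)))
    (hu : mulU (a : k) (b : k) ∈ R) : inv _ ∈ R := by
  have h1 : inv (Polynomial.X : Polynomial k) = algebraMap k _ (b : k)⁻¹ *
      (algebraMap k _ (toU (a : k))⁻¹ * mulU (a : k) (b : k) - algebraMap k _ (1 - (b : k))) := by
    have h2 : algebraMap k (ParamRing (Polynomial.X : Polynomial k)) (b : k)⁻¹ *
        algebraMap k _ (b : k) = 1 := by
      rw [← map_mul, inv_mul_cancel₀ b.ne_zero, map_one]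
    have h3 : algebraMap k (ParamRing (Polynomial.X : Polynomial k)) (toU (a : k))⁻¹ *
        algebraMap k _ (toU (a : k)) = 1 := by
      rw [← map_mul, inv_mul_cancel₀ (toU_ne_zero ha), map_one]
    have := coord_mul_inv (k := k)
    set B := algebraMap k (ParamRing (Polynomial.X : Polynomial k)) (b : k)⁻¹
    set C := algebraMap k (ParamRing (Polynomial.X : Polynomial k)) (1 - (b : k))
    rw [mulU]
    linear_combination (-inv Polynomial.X) * h2 - B * C * this -
      B * (C * coord Polynomial.X + algebraMap k _ (b : k)) * inv Polynomial.X * h3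
  rw [h1]
  exact mul_mem (R.algebraMap_mem _)
    (sub_mem (mul_mem (R.algebraMap_mem _) hu) (R.algebraMap_mem _))

/-- The zeros of `t - b`, where `s = t / (t - 1)`. -/
def zeroPoints (b : kˣ) : Multiset (ParamPoint (Polynomial.X : Polynomial k)) :=
  open Classical in
  if h : (b : k) = 1 then 0 else {nonzeroPoint (toU (b : k)) (toU_ne_zero h)}

/-- The pole of y is at t = a b. If a b = 1 this is the point t = 1, that is s = ∞, which is not on
the curve. -/
theorem associated_mulU_sub_one {a b : kˣ} (ha : (a : k) ≠ 1) :
    Associated (mulU (a : k) (b : k) - 1) ((zeroPoints (a * b)).map linear).prod := by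
  have h0 := inv_ne_zero (sub_ne_zero.2 ha)
  rw [zeroPoints, mulU_sub_one ha]
  split_ifs with h
  · rw [Units.val_mul] at h
    rw [h, sub_self, map_zero, zero_mul, zero_add, map_one, mul_one]
    exact associated_zero ((isUnit_algebraMap h0).mul isUnit_inv)
  · refine associated_singleton _
      (g := algebraMap k _ ((a - 1 : k)⁻¹ * (1 - a * b)) * inv _) ?_ ?_
    · rw [Units.val_mul] at h
      exact (isUnit_algebraMap (mul_ne_zero h0 (sub_ne_zero.2 (Ne.symm h)))).mul isUnit_inv
    · have h1 := congrArg (algebraMap k (ParamRing (Polynomial.X : Polynomial k)))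
        (one_sub_mul_toU h)
      rw [map_mul, map_neg] at h1
      rw [map_mul _ (a - 1 : k)⁻¹, nonzeroPoint, ← Units.val_mul]
      linear_combination (algebraMap k _ (a - 1 : k)⁻¹ * inv Polynomial.X) * h1

/-- On the curve with x constant and adjacent coordinates t and y = a (t - b) / (t - a b), the pole
of t gives y = a, the zero of y gives t = b, and the pole of y gives t = a b. At t = 0 one has y =
1, so this point is removed and t has no zero. -/
theorem pointClass_update_mul_of_ne_one (c : k) (w : Fin n → kˣ) (i : Fin n) {a b : kˣ}
    (ha : (a : k) ≠ 1) (hb : (b : k) ≠ 1) :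
    pointClass c (Function.update w i (a * b)) =
      pointClass c (Function.update w i a) + pointClass c (Function.update w i b) := by
  rcases eq_or_ne c 0 with rfl | hc
  · simp
  by_cases hw : ∀ j, j ≠ i → (w j : k) ≠ 1
  swap
  · push Not at hw
    obtain ⟨j, hji, hj⟩ := hw
    rw [pointClass_eq_zero_of_eq_one _ j, pointClass_eq_zero_of_eq_one _ j,
      pointClass_eq_zero_of_eq_one _ j, add_zero] <;>
    simpa [hji] using hj
  set v : Fin n → ParamRing (Polynomial.X : Polynomial k) :=
    Function.update (fun j => constU _ (w j)) i (mulU (a : k) (b : k)) with hv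
  have hvi : v i = mulU (a : k) (b : k) := by simp [hv]
  have hvj : ∀ j, j ≠ i → v j = constU _ (w j) := fun j hj => by simp [hv, hj]
  set u : Fin (n + 1) → ParamRing (Polynomial.X : Polynomial k) := Fin.insertNth i.castSucc (coord _) v with hu
  have hu0 : u i.castSucc = coord _ := by simp [hu]
  have hui : ∀ j, u (i.castSucc.succAbove j) = v j := fun j => by simp [hu]
  set x : ParamRing (Polynomial.X : Polynomial k) := algebraMap k _ c⁻¹ with hx
  have hx' : ∀ r, eval r x = c⁻¹ := fun r => (eval r).commutes _
  have hs : Function.Surjective (paramHom (k := k) x u) :=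
    paramHom_surjective _ _ (hu0 ▸ mem_range_paramHom_u (k := k) x u i.castSucc)
      (inv_mem_of_mulU_mem ha _ (by
        rw [← hvi, ← hui]
        exact mem_range_paramHom_u (k := k) x u _))
  -- The parameter s = 1 is t = ∞, where y takes the value a.
  have H0 : HasCoords (nonzeroPoint 1 one_ne_zero) x (fun j => u (i.castSucc.succAbove j)) c
      (Function.update w i a) := by
    refine ⟨hc, hx' _, fun j => ?_⟩
    simp only [hui]
    rcases eq_or_ne j i with rfl | hj
    · rw [hvi, Function.update_self]
      exact ⟨ha, by simp [mulU, nonzeroPoint]⟩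
    · rw [hvj j hj, Function.update_of_ne hj]
      exact ⟨hw j hj, by simp [constU]⟩
  have H1 : ∀ (y : kˣ) (hy : (y : k) ≠ 1), HasCoords (nonzeroPoint (toU (y : k)) (toU_ne_zero hy)) x
      (fun j => u ((i.castSucc.succAbove i).succAbove j)) c (Function.update w i y) := by
    refine fun y hy => ⟨hc, hx' _, fun j => ?_⟩
    simp only [Fin.succAbove_castSucc_self]
    rcases eq_or_ne j i with rfl | hj
    · rw [succ_succAbove_self, hu0, Function.update_self]
      exact ⟨hy, by simp [nonzeroPoint]⟩
    · rw [succ_succAbove_of_ne hj, hui, hvj j hj, Function.update_of_ne hj]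
      exact ⟨hw j hj, by simp [constU]⟩
  have H1' : ∀ (y : kˣ), ∀ r ∈ zeroPoints y, HasCoords r x
      (fun j => u ((i.castSucc.succAbove i).succAbove j)) c (Function.update w i y) := by
    intro y r hr
    rw [zeroPoints] at hr
    split_ifs at hr with h
    · simp at hr
    · rw [Multiset.mem_singleton.1 hr]
      exact H1 y h
  have hsum : ∀ y : kˣ, ((zeroPoints y).map fun r => (QuotientAddGroup.mk (pointCycle (eval r x)
      fun j => eval r (u ((i.castSucc.succAbove i).succAbove j))) : TH k n)).sum =
      pointClass c (Function.update w i y) := by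
    intro y
    rw [Multiset.map_congr rfl fun r hr => (H1' y r hr).mk_pointCycle, zeroPoints]
    split_ifs with h
    · rw [Multiset.map_zero, Multiset.sum_zero, pointClass_eq_zero_of_eq_one _ i]
      simpa using h
    · rw [Multiset.map_singleton, Multiset.sum_singleton]
  have hzb : zeroPoints b = {nonzeroPoint (toU (b : k)) (toU_ne_zero hb)} := dif_neg hb
  have hval : (i.castSucc.succAbove i : ℕ) = i + 1 := by
    rw [Fin.succAbove_castSucc_self, Fin.val_succ]
  have key := sum_pointCycle_eq_zero (nonzeroPoint 1 one_ne_zero) x u hs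
    (algebraMap_ne_zero (nonzeroPoint 1 one_ne_zero) (inv_ne_zero hc))
    (Fin.insertNth i.castSucc 0 (Function.update (fun _ => 0) i (zeroPoints b)))
    (Fin.insertNth i.castSucc {nonzeroPoint 1 one_ne_zero}
      (Function.update (fun _ => 0) i (zeroPoints (a * b))))
    ((Fin.forall_iff_succAbove i.castSucc).2 ⟨?_, fun j => ?_⟩)
    ((Fin.forall_iff_succAbove i.castSucc).2 ⟨?_, fun j => ?_⟩)
    ((Fin.forall_iff_succAbove i.castSucc).2 ⟨fun r hr => ?_, fun j r hr => ?_⟩)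
    (hasModulusTwo_of_const _ (inv_ne_zero hc) u hs)
  · rw [Fin.sum_univ_succAbove _ i.castSucc, Finset.sum_eq_single i (fun j _ hj => by simp [hj])
      (by simp)] at key
    simp only [Fin.insertNth_apply_same, Fin.insertNth_apply_succAbove, Function.update_self, hsum,
      Multiset.map_singleton, Multiset.sum_singleton, Multiset.map_zero, Multiset.sum_zero,
      H0.mk_pointCycle, hval, Fin.val_castSucc, pow_succ] at key
    rw [← sub_eq_zero]
    rcases neg_one_pow_eq_or ℤ (i : ℕ) with h | h <;> rw [h] at key
    · rw [← neg_eq_zero, ← key]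
      module
    · rw [← key]
      module
  · rw [hu0, Fin.insertNth_apply_same]
    exact associated_zero (IsUnit.of_mul_eq_one _ coord_mul_inv)
  · rw [hui, Fin.insertNth_apply_succAbove]
    rcases eq_or_ne j i with rfl | hj
    · rw [hvi, Function.update_self, hzb]
      exact associated_singleton _ ((isUnit_algebraMap (mul_ne_zero (toU_ne_zero ha)
        (sub_ne_zero.2 hb.symm))).mul isUnit_inv) (mulU_eq hb)
    · rw [hvj j hj, Function.update_of_ne hj]
      exact associated_constU (hw j hj)
  · rw [hu0, Fin.insertNth_apply_same]
    exact associated_singleton _ isUnit_one (by simp [nonzeroPoint])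
  · rw [hui, Fin.insertNth_apply_succAbove]
    rcases eq_or_ne j i with rfl | hj
    · rw [hvi, Function.update_self]
      exact associated_mulU_sub_one ha
    · rw [hvj j hj, Function.update_of_ne hj]
      exact associated_constU_sub_one (hw j hj)
  · obtain rfl : r = nonzeroPoint 1 one_ne_zero := by simpa using hr
    exact H0.off
  · rw [Fin.insertNth_apply_succAbove, Fin.insertNth_apply_succAbove] at hr
    rcases eq_or_ne j i with rfl | hj
    · rw [Function.update_self, Function.update_self, Multiset.mem_add] at hr
      exact hr.elim (fun h => (H1' _ r h).off) fun h => (H1' _ r h).off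
    · simp [hj] at hr

theorem pointClass_update_mul (c : k) (w : Fin n → kˣ) (i : Fin n) (a b : kˣ) :
    pointClass c (Function.update w i (a * b)) =
      pointClass c (Function.update w i a) + pointClass c (Function.update w i b) := by
  have h1 : pointClass c (Function.update w i 1) = 0 :=
    pointClass_eq_zero_of_eq_one _ i (by simp)
  by_cases ha : (a : k) = 1
  · rw [Units.val_eq_one.1 ha, one_mul, h1, zero_add]
  by_cases hb : (b : k) = 1
  · rw [Units.val_eq_one.1 hb, mul_one, h1, add_zero]
  exact pointClass_update_mul_of_ne_one c w i ha hb

end Relations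

/-! ### The Steinberg relation and the alternating property. -/

section Relations

variable {k : Type*} [Field k]

open ParamRing

variable {n : ℕ}

section Steinberg

variable (k) in
/-- The polynomial `s (s - 1)`. -/
def twoPts : Polynomial k := Polynomial.X * (Polynomial.X - 1)

theorem ofPoly_twoPts : ofPoly (twoPts k) (twoPts k) = coord _ * (coord _ - 1) :=
  (map_mul (ofPoly (twoPts k)) Polynomial.X (Polynomial.X - 1)).trans
    (by rw [map_sub, map_one, ofPoly_X])

variable (k) in
/-- The function `1 / s`. -/
def invCoord : ParamRing (twoPts k) := inv _ * (coord _ - 1)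

variable (k) in
/-- The function `1 / (s - 1)`. -/
def invCoordSubOne : ParamRing (twoPts k) := inv _ * coord _

theorem coord_mul_invCoord : coord (twoPts k) * invCoord k = 1 := by
  have := ofPoly_mul_inv (q := twoPts k)
  rw [ofPoly_twoPts] at this
  rw [invCoord]
  linear_combination this

theorem coord_sub_one_mul_invCoordSubOne : (coord (twoPts k) - 1) * invCoordSubOne k = 1 := by
  have := ofPoly_mul_inv (q := twoPts k)
  rw [ofPoly_twoPts] at this
  rw [invCoordSubOne]
  linear_combination this

theorem inv_twoPts : inv (twoPts k) = invCoord k * invCoordSubOne k := by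
  have := ofPoly_mul_inv (q := twoPts k)
  rw [ofPoly_twoPts] at this
  rw [invCoord, invCoordSubOne]
  linear_combination (-inv (twoPts k)) * this

theorem isUnit_coord : IsUnit (coord (twoPts k)) := IsUnit.of_mul_eq_one _ coord_mul_invCoord

theorem isUnit_coord_sub_one : IsUnit (coord (twoPts k) - 1) :=
  IsUnit.of_mul_eq_one _ coord_sub_one_mul_invCoordSubOne

theorem isUnit_invCoord : IsUnit (invCoord k) :=
  IsUnit.of_mul_eq_one _ ((mul_comm _ _).trans coord_mul_invCoord)

theorem isUnit_invCoordSubOne : IsUnit (invCoordSubOne k) :=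
  IsUnit.of_mul_eq_one _ ((mul_comm _ _).trans coord_sub_one_mul_invCoordSubOne)

/-- The Steinberg relation. -/
theorem pointClass_steinberg (c : k) (w : Fin n → kˣ) {i j : Fin n} (hij : i ≠ j) {a b : kˣ}
    (hab : (a : k) + b = 1) :
    pointClass c (Function.update (Function.update w i a) j b) = 0 := by
  rcases eq_or_ne c 0 with rfl | hc
  · simp
  by_cases hw : ∀ l, l ≠ i → l ≠ j → (w l : k) ≠ 1
  swap
  · push Not at hw
    obtain ⟨l, hli, hlj, hl⟩ := hw
    rw [pointClass_eq_zero_of_eq_one _ l]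
    simpa [hli, hlj] using hl
  have ha : (a : k) ≠ 1 := fun h => b.ne_zero (by simp [h] at hab)
  have hb : (b : k) ≠ 1 := fun h => a.ne_zero (by simp [h] at hab)
  have hρ : toU (a : k) - 1 ≠ 0 := toU_sub_one_ne_zero ha
  let ρ : ParamPoint (twoPts k) := ⟨toU (a : k), by
    simpa [twoPts] using ⟨toU_ne_zero ha, hρ⟩⟩
  -- In terms of t with s = t / (t - 1), the curve is y_i = t, y_j = 1 - t, and a new first
  -- coordinate (t - a) / (t - 1), given by `u₀`. Every zero or pole other than t = a is at t = 0, 1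
  -- or ∞, where some coordinate equals 1: at t = 0 it is y_j, at t = 1 it is y_i, and at t = ∞ it
  -- is the new coordinate. So the boundary is a single point.
  set v : Fin n → ParamRing (twoPts k) :=
    Function.update (Function.update (fun l => constU _ (w l)) i (coord _)) j (invCoord k) with hv
  have hvi : v i = coord _ := by simp [hv, hij]
  have hvj : v j = invCoord k := by simp [hv]
  have hvl : ∀ l, l ≠ i → l ≠ j → v l = constU _ (w l) := fun l hi hj => by simp [hv, hi, hj]
  set u₀ : ParamRing (twoPts k) := (coord _ - algebraMap k _ ρ.1) * invCoordSubOne k with hu₀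
  have hu₀' : u₀ - 1 = algebraMap k _ (1 - toU (a : k)) * invCoordSubOne k := by
    rw [hu₀, map_sub, map_one]
    linear_combination coord_sub_one_mul_invCoordSubOne (k := k)
  have hρ' : (1 : k) - toU (a : k) ≠ 0 := by
    rw [← neg_sub]
    exact neg_ne_zero.2 hρ
  set u : Fin (n + 1) → ParamRing (twoPts k) := Fin.cons u₀ v with hu
  set x : ParamRing (twoPts k) := algebraMap k _ c⁻¹ with hx
  have hx' : ∀ r, eval r x = c⁻¹ := fun r => (eval r).commutes _
  have hs : Function.Surjective (paramHom (k := k) x u) := by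
    refine paramHom_surjective _ _ (hvi ▸ mem_range_paramHom_u (k := k) x u i.succ) ?_
    rw [inv_twoPts]
    refine mul_mem (hvj ▸ mem_range_paramHom_u (k := k) x u j.succ) ?_
    have h1 : invCoordSubOne k = algebraMap k _ (1 - toU (a : k))⁻¹ * (u₀ - 1) := by
      rw [hu₀', ← mul_assoc, ← map_mul, inv_mul_cancel₀ hρ', map_one, one_mul]
    rw [h1]
    exact mul_mem (Subalgebra.algebraMap_mem _ _)
      (sub_mem (mem_range_paramHom_u (k := k) x u 0) (one_mem _))
  have H0 : HasCoords ρ x (fun l => u (Fin.succAbove 0 l)) c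
      (Function.update (Function.update w i a) j b) := by
    refine ⟨hc, hx' _, fun l => ?_⟩
    simp only [Fin.zero_succAbove, hu, Fin.cons_succ]
    rcases eq_or_ne l j with rfl | hlj
    · rw [hvj, Function.update_self]
      refine ⟨hb, ?_⟩
      have h1 := congrArg (eval ρ) (coord_mul_invCoord (k := k))
      rw [map_mul, map_one, eval_coord] at h1
      rw [eq_inv_of_mul_eq_one_right h1]
      change (toU (a : k))⁻¹ = _
      have h2 : (a : k) - 1 = -b := by rw [← hab, sub_add_cancel_left]
      have h3 : (b : k) - 1 = -a := by rw [← hab, sub_add_cancel_right]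
      simp only [toU, h2, h3, div_neg, inv_neg, inv_div]
    · rcases eq_or_ne l i with rfl | hli
      · rw [hvi, Function.update_of_ne hlj, Function.update_self, eval_coord]
        exact ⟨ha, rfl⟩
      · rw [hvl l hli hlj, Function.update_of_ne hlj, Function.update_of_ne hli]
        exact ⟨hw l hli hlj, (eval ρ).commutes _⟩
  have key := sum_pointCycle_eq_zero ρ x u hs (algebraMap_ne_zero ρ (inv_ne_zero hc))
    (Fin.cons {ρ} fun _ => 0) (fun _ => 0)
    (Fin.forall_fin_succ.2 ⟨associated_singleton _ isUnit_invCoordSubOne rfl, fun l => ?_⟩)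
    (Fin.forall_fin_succ.2 ⟨associated_zero (by
      rw [hu, Fin.cons_zero, hu₀']
      exact (isUnit_algebraMap hρ').mul isUnit_invCoordSubOne), fun l => ?_⟩)
    (Fin.forall_fin_succ.2 ⟨fun r hr => by
        obtain rfl : r = ρ := by simpa using hr
        exact H0.off, fun l r hr => by simp at hr⟩)
    (hasModulusTwo_of_const _ (inv_ne_zero hc) u hs)
  · rw [Fin.sum_univ_succ] at key
    simpa only [Fin.cons_zero, Fin.cons_succ, Multiset.map_singleton, Multiset.sum_singleton,
      Multiset.map_zero, Multiset.sum_zero, sub_zero, H0.mk_pointCycle, smul_zero,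
      Finset.sum_const_zero, add_zero, Fin.val_zero, zero_add, pow_one, neg_smul, one_smul,
      neg_eq_zero] using key
  · rw [hu, Fin.cons_succ, Fin.cons_succ]
    rcases eq_or_ne l j with rfl | hlj
    · rw [hvj]
      exact associated_zero isUnit_invCoord
    · rcases eq_or_ne l i with rfl | hli
      · rw [hvi]
        exact associated_zero isUnit_coord
      · rw [hvl l hli hlj]
        exact associated_constU (hw l hli hlj)
  · rw [hu, Fin.cons_succ]
    rcases eq_or_ne l j with rfl | hlj
    · rw [hvj]
      have : invCoord k - 1 = - ((coord _ - 1) * invCoord k) := by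
        linear_combination coord_mul_invCoord (k := k)
      rw [this]
      exact associated_zero (isUnit_coord_sub_one.mul isUnit_invCoord).neg
    · rcases eq_or_ne l i with rfl | hli
      · rw [hvi]
        exact associated_zero isUnit_coord_sub_one
      · rw [hvl l hli hlj]
        exact associated_constU_sub_one (hw l hli hlj)

end Steinberg

theorem pointClass_update_inv (c : k) (w : Fin n → kˣ) (i : Fin n) (a : kˣ) :
    pointClass c (Function.update w i a⁻¹) = -pointClass c (Function.update w i a) := by
  rw [eq_neg_iff_add_eq_zero, ← pointClass_update_mul, inv_mul_cancel]
  exact pointClass_eq_zero_of_eq_one _ i (by simp)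

theorem pointClass_neg (c : k) (w : Fin n → kˣ) : pointClass (-c) w = -pointClass c w := by
  rw [eq_neg_iff_add_eq_zero, ← pointClass_add, neg_add_cancel, pointClass_zero]

/-- Split c into two halves: twice the symbol with entry -1 has entry (-1)² = 1. -/
theorem pointClass_update_neg_one (h2 : (2 : k) ≠ 0) (c : k) (w : Fin n → kˣ) (i : Fin n) :
    pointClass c (Function.update w i (-1)) = 0 := by
  have : NeZero (2 : k) := ⟨h2⟩
  rw [← add_halves c, pointClass_add, ← pointClass_update_mul, neg_one_mul, neg_neg]
  exact pointClass_eq_zero_of_eq_one _ i (by simp)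

theorem pointClass_update_neg (h2 : (2 : k) ≠ 0) (c : k) (w : Fin n → kˣ) (i : Fin n) (a : kˣ) :
    pointClass c (Function.update w i (-a)) = pointClass c (Function.update w i a) := by
  rw [← neg_one_mul, pointClass_update_mul, pointClass_update_neg_one h2, zero_add]

/-- The Milnor K-theory argument: -a = (1 - a) / (1 - a⁻¹), so two Steinberg relations kill the
symbol with entries a, -a, and the sign does not matter. -/
theorem pointClass_update_update_self (h2 : (2 : k) ≠ 0) (c : k) (w : Fin n → kˣ) {i j : Fin n}
    (hij : i ≠ j) (a : kˣ) :
    pointClass c (Function.update (Function.update w i a) j a) = 0 := by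
  by_cases ha : (a : k) = 1
  · exact pointClass_eq_zero_of_eq_one _ j (by simpa using ha)
  have h1 : (1 : k) - a ≠ 0 := sub_ne_zero.2 (Ne.symm ha)
  have h1' : (1 : k) - (a⁻¹ : kˣ) ≠ 0 := by
    rwa [Units.val_inv_eq_inv_val, sub_ne_zero, ne_comm, Ne, inv_eq_one]
  obtain ⟨b, hb⟩ : ∃ b : kˣ, (b : k) = 1 - a := ⟨Units.mk0 _ h1, rfl⟩
  obtain ⟨b', hb'⟩ : ∃ b : kˣ, (b : k) = 1 - (a⁻¹ : kˣ) := ⟨Units.mk0 _ h1', rfl⟩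
  have s1 := pointClass_steinberg c w hij (a := a) (b := b) (by rw [hb]; ring)
  have s2 := pointClass_steinberg c w hij (a := a⁻¹) (b := b') (by rw [hb']; ring)
  have e : -a = b * b'⁻¹ := by
    rw [eq_mul_inv_iff_mul_eq]
    ext
    rw [Units.val_mul, Units.val_neg, hb, hb', mul_sub, neg_mul, neg_mul, ← Units.val_mul,
      mul_inv_cancel, Units.val_one]
    ring
  rw [Function.update_comm hij, pointClass_update_inv, neg_eq_zero, Function.update_comm hij.symm]
    at s2
  rw [← pointClass_update_neg h2, e, pointClass_update_mul, pointClass_update_inv, s1, s2]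
  simp

theorem pointClass_eq_zero_of_eq (h2 : (2 : k) ≠ 0) (c : k) (w : Fin n → kˣ) {i j : Fin n}
    (hij : i ≠ j) (h : w i = w j) : pointClass c w = 0 := by
  have := pointClass_update_update_self h2 c w hij (w i)
  rwa [Function.update_eq_self, h, Function.update_eq_self] at this

end Relations

/-! ### Additivity of a ↦ [c a; a, w]. -/

section Relations

variable {k : Type*} [Field k]

/-- An odd function with values in a group, whose deviation from additivity is additive in one
variable away from the degenerate positions, is additive if `6` is invertible. The parameter `c`
provides the divisibility. -/
theorem additive_of_deviation {T : Type*} [AddCommGroup T] (h2 : (2 : k) ≠ 0) (h3 : (3 : k) ≠ 0)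
    (D : k → k → T) (hc : ∀ c c' a, D (c + c') a = D c a + D c' a) (h0 : ∀ c, D c 0 = 0)
    (hneg : ∀ c a, D c (-a) = -D c a)
    (h : ∀ c α α' β, α ≠ 0 → α' ≠ 0 → β ≠ 0 → α + β ≠ 0 → α' + β ≠ 0 → α + α' + β ≠ 0 →
      D c (α + α' + β) - D c (α + α') - D c β =
        (D c (α + β) - D c α - D c β) + (D c (α' + β) - D c α' - D c β))
    (c α β : k) : D c (α + β) = D c α + D c β := by
  set E : k → k → k → T := fun c β α => D c (α + β) - D c α - D c β with hE
  have hEc : ∀ c c' β α, E (c + c') β α = E c β α + E c' β α := by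
    intro c c' β α
    simp only [hE, hc]
    abel
  have hE0 : ∀ c β, E c β 0 = 0 := fun c β => by simp [hE, h0]
  have hEn : ∀ c β, E c β (-β) = 0 := fun c β => by simp [hE, h0, hneg]
  have G : ∀ c β α α', β ≠ 0 → α + β ≠ 0 → α' + β ≠ 0 → α + α' + β ≠ 0 →
      E c β (α + α') = E c β α + E c β α' := by
    intro c β α α' hβ h1 h2 h3
    rcases eq_or_ne α 0 with rfl | hα
    · rw [hE0, zero_add, zero_add]
    rcases eq_or_ne α' 0 with rfl | hα'
    · rw [hE0, add_zero, add_zero]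
    exact h c α α' β hα hα' hβ h1 h2 h3
  have hββ : ∀ c β, β ≠ 0 → E c β β = 0 := by
    intro c β hβ
    have h2β : β + β ≠ 0 := by
      rw [← two_mul]
      exact mul_ne_zero h2 hβ
    have h3β : β + β + β ≠ 0 := by
      have : β + β + β = 3 * β := by ring
      rw [this]
      exact mul_ne_zero h3 hβ
    -- Generic additivity gives E(β, 2β) = 2 E(β, β) and E(β, -2β) + E(β, 2β) = E(β, 0) = 0, while
    -- oddness of D gives E(β, -2β) = E(β, β). Dividing `c` by 3 then removes the factor 3.
    have key : ∀ c, E c β β + E c β β + E c β β = 0 := by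
      intro c
      have e1 := G c β β β hβ h2β h2β h3β
      have e2 := G c β (-(β + β)) (β + β) hβ (by simpa using hβ) h3β (by simpa using hβ)
      rw [neg_add_cancel, hE0] at e2
      have e3 : E c β (-(β + β)) = E c β β := by
        simp only [hE, neg_add_rev, neg_add_cancel_right, hneg]
        rw [← neg_add_rev, hneg]
        abel
      rw [e3, e1] at e2
      rw [e2, add_assoc]
    have : c = c / 3 + c / 3 + c / 3 := by
      field_simp
      ring
    rw [this, hEc, hEc]
    exact key _
  have A : ∀ c β α α', β ≠ 0 → E c β (α + α') = E c β α + E c β α' := by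
    intro c β α α' hβ
    have h2β : β + β ≠ 0 := by
      rw [← two_mul]
      exact mul_ne_zero h2 hβ
    -- Translation by β is harmless since E(β, β) = 0. It moves arguments out of the degenerate
    -- positions.
    have step : ∀ α, E c β (α - β) = E c β α := by
      intro α
      rcases eq_or_ne α 0 with rfl | hα
      · rw [zero_sub, hEn, hE0]
      rcases eq_or_ne (α + β) 0 with hαβ | hαβ
      · have h3β : β + β + β ≠ 0 := by
          have : β + β + β = 3 * β := by ring
          rw [this]
          exact mul_ne_zero h3 hβ
        rw [eq_neg_of_add_eq_zero_left hαβ, hEn]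
        have e2 := G c β (-β - β) (β + β) hβ (by simpa using hβ) h3β (by simpa using hβ)
        rw [G c β β β hβ h2β h2β h3β, hββ c β hβ, add_zero, add_zero] at e2
        rw [← e2]
        simp [hE0]
      · have := G c β (α - β) β hβ (by simpa using hα) h2β (by simpa using hαβ)
        rw [hββ c β hβ, add_zero, sub_add_cancel] at this
        exact this.symm
    have gen : ∀ α α', α + β ≠ 0 → α' + β ≠ 0 → E c β (α + α') = E c β α + E c β α' := by
      intro α α' h1 h1'
      rcases eq_or_ne (α + α' + β) 0 with h4 | h4
      · rcases eq_or_ne α 0 with rfl | hα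
        · rw [hE0, zero_add, zero_add]
        have e1 := step (-α)
        have e2 : -α - β = α' := by linear_combination -h4
        rw [e2] at e1
        rw [e1, eq_neg_of_add_eq_zero_left h4, hEn]
        rcases eq_or_ne α β with rfl | hαβ
        · rw [hEn, hββ c α hβ, add_zero]
        · rw [← G c β α (-α) hβ h1 (by
            rw [neg_add_eq_sub, sub_ne_zero]
            exact hαβ.symm) (by simpa using hβ), add_neg_cancel, hE0]
      · exact G c β α α' hβ h1 h1' h4
    rcases eq_or_ne (α + β) 0 with h1 | h1
    · rw [eq_neg_of_add_eq_zero_left h1, hEn, zero_add, neg_add_eq_sub, step]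
    rcases eq_or_ne (α' + β) 0 with h1' | h1'
    · rw [eq_neg_of_add_eq_zero_left h1', hEn, add_zero, ← sub_eq_add_neg, step]
    exact gen α α' h1 h1'
  have S : ∀ c α β, E c β α = E c α β := by
    intro c α β
    simp only [hE, add_comm β α]
    abel
  -- Biadditivity makes E even under simultaneous change of sign; oddness of D makes it odd.
  have Z : ∀ c β α, β ≠ 0 → α ≠ 0 → E c β α + E c β α = 0 := by
    intro c β α hβ hα
    have n1 : E c β (-α) = -E c β α := by
      rw [eq_neg_iff_add_eq_zero, ← A c β _ _ hβ, neg_add_cancel, hE0]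
    have n2 : E c (-β) (-α) = E c β α := by
      rw [S, ← neg_neg (E c β α), ← n1, S c (-α) β, eq_neg_iff_add_eq_zero,
        ← A c (-α) _ _ (neg_ne_zero.2 hα), neg_add_cancel, hE0]
    have n3 : E c (-β) (-α) = -E c β α := by
      simp only [hE, ← neg_add, hneg]
      abel
    nth_rw 1 [← n2]
    rw [n3, neg_add_cancel]
  have F : E c β α = 0 := by
    rcases eq_or_ne β 0 with rfl | hβ
    · rw [S, hE0]
    rcases eq_or_ne α 0 with rfl | hα
    · rw [hE0]
    have : NeZero (2 : k) := ⟨h2⟩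
    rw [← add_halves c, hEc]
    exact Z _ β α hβ hα
  rw [← sub_eq_zero, ← F]
  simp only [hE]
  abel

variable {n : ℕ}

theorem pointClass_cons_mul (c : k) (w : Fin n → kˣ) {a b : k} (ha : a ≠ 0) (hb : b ≠ 0) :
    pointClass c (Fin.cons (unitOf (a * b)) w : Fin (n + 1) → kˣ) =
      pointClass c (Fin.cons (unitOf a) w : Fin (n + 1) → kˣ) +
        pointClass c (Fin.cons (unitOf b) w : Fin (n + 1) → kˣ) := by
  have := pointClass_update_mul c (Fin.cons 1 w : Fin (n + 1) → kˣ) 0 (unitOf a) (unitOf b)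
  rwa [Fin.update_cons_zero, Fin.update_cons_zero, Fin.update_cons_zero, ← unitOf_mul ha hb] at this

theorem pointClass_cons_div (c : k) (w : Fin n → kˣ) {a b : k} (ha : a ≠ 0) (hb : b ≠ 0) :
    pointClass c (Fin.cons (unitOf (a / b)) w : Fin (n + 1) → kˣ) =
      pointClass c (Fin.cons (unitOf a) w : Fin (n + 1) → kˣ) -
        pointClass c (Fin.cons (unitOf b) w : Fin (n + 1) → kˣ) := by
  rw [eq_sub_iff_add_eq, ← pointClass_cons_mul c w (div_ne_zero ha hb) hb, div_mul_cancel₀ _ hb]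

theorem pointClass_cons_neg (h2 : (2 : k) ≠ 0) (c : k) (w : Fin n → kˣ) (a : k) :
    pointClass c (Fin.cons (unitOf (-a)) w : Fin (n + 1) → kˣ) =
      pointClass c (Fin.cons (unitOf a) w : Fin (n + 1) → kˣ) := by
  rcases eq_or_ne a 0 with rfl | ha
  · rw [neg_zero]
  have := pointClass_update_neg h2 c (Fin.cons 1 w : Fin (n + 1) → kˣ) 0 (unitOf a)
  rw [Fin.update_cons_zero, Fin.update_cons_zero] at this
  rw [← this]
  congr 2
  ext
  rw [coe_unitOf (neg_ne_zero.2 ha), Units.val_neg, coe_unitOf ha]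

/-- This is `pointClass_lin_quad` with p = 1/(cα), p' = 1/(cα'), e = -1/(cβ). Then 1 - p/e = (α +
β)/α, and the value of the quadratic coordinate at e is (α + β)(α' + β) / (β (α + α' + β)).
Expanding the symbols multiplicatively and collecting equal second entries gives the claim. -/
theorem deviation_pointClass (w : Fin n → kˣ) (c α α' β : k) (hα : α ≠ 0)
    (hα' : α' ≠ 0) (hβ : β ≠ 0) (h1 : α + β ≠ 0) (h1' : α' + β ≠ 0) (h1'' : α + α' + β ≠ 0)
    (D : k → k → TH k (n + 1))
    (hD : ∀ c a, D c a = pointClass (c * a) (Fin.cons (unitOf a) w : Fin (n + 1) → kˣ)) :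
    D c (α + α' + β) - D c (α + α') - D c β =
      (D c (α + β) - D c α - D c β) + (D c (α' + β) - D c α' - D c β) := by
  rcases eq_or_ne c 0 with rfl | hc
  · simp [hD]
  have hg : ((-(c * β)⁻¹ - (c * α)⁻¹) * (-(c * β)⁻¹ - (c * α')⁻¹)) / ((c * α)⁻¹ * (c * α')⁻¹ -
      ((c * α)⁻¹ + (c * α')⁻¹) * -(c * β)⁻¹) = (α + β) * (α' + β) / (β * (α + α' + β)) := by
    have e1 : (c * α)⁻¹ * (c * α')⁻¹ - ((c * α)⁻¹ + (c * α')⁻¹) * -(c * β)⁻¹ =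
        (α + α' + β) / (c ^ 2 * α * α' * β) := by
      field_simp
      ring
    rw [e1]
    field_simp
    ring
  have hd : ∀ a, a ≠ 0 → a + β ≠ 0 → -(c * β)⁻¹ ≠ (c * a)⁻¹ := by
    intro a ha hab h
    rw [← inv_neg, inv_inj, ← mul_neg] at h
    exact hab (by rw [← mul_left_cancel₀ hc h, neg_add_cancel])
  have hq : ∀ a, a ≠ 0 → 1 - (c * a)⁻¹ / -(c * β)⁻¹ = (a + β) / a := by
    intro a ha
    field_simp
    ring
  have key := pointClass_lin_quad (inv_ne_zero (mul_ne_zero hc hα))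
    (inv_ne_zero (mul_ne_zero hc hα')) (neg_ne_zero.2 (inv_ne_zero (mul_ne_zero hc hβ)))
    (fun h0 => by
      rw [h0, div_zero, eq_comm, div_eq_zero_iff] at hg
      exact hg.elim (mul_ne_zero h1 h1') (mul_ne_zero hβ h1'')) (hd α hα h1) (hd α' hα' h1') w
  rw [hg, hq α hα, hq α' hα', inv_neg, inv_inv, inv_inv, inv_inv, pointClass_neg,
    pointClass_cons_div _ _ h1 hα, pointClass_cons_div _ _ h1' hα',
    pointClass_cons_div _ _ (mul_ne_zero h1 h1') (mul_ne_zero hβ h1''), pointClass_cons_mul _ _ h1 h1',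
    pointClass_cons_mul _ _ hβ h1''] at key
  have hs : pointClass (c * α + c * α') (Fin.cons (unitOf (1 - (c * α)⁻¹ * (c * α')⁻¹ /
      ((c * α)⁻¹ + (c * α')⁻¹) / -(c * β)⁻¹)) w : Fin (n + 1) → kˣ) =
      pointClass (c * (α + α')) (Fin.cons (unitOf (α + α' + β)) w : Fin (n + 1) → kˣ) -
        pointClass (c * (α + α')) (Fin.cons (unitOf (α + α')) w : Fin (n + 1) → kˣ) := by
    rw [← mul_add]
    -- If α + α' = 0, the second entry on the left involves a division by zero, but every symbol
    -- here has first entry 0.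
    rcases eq_or_ne (α + α') 0 with h0 | h0
    · simp [h0]
    · rw [← pointClass_cons_div _ _ h1'' h0, ← hq _ h0]
      congr 5
      field_simp
      rw [add_comm α' α, div_self h0]
  rw [hs] at key
  simp only [hD]
  rw [← sub_eq_zero] at key ⊢
  rw [← key]
  simp only [mul_add, pointClass_add]
  abel

/-- Additivity of `a ↦ [c a; a, w]`. -/
theorem pointClass_mul_cons_add (h2 : (2 : k) ≠ 0) (h3 : (3 : k) ≠ 0) (w : Fin n → kˣ)
    (c a b : k) :
    pointClass (c * (a + b)) (Fin.cons (unitOf (a + b)) w : Fin (n + 1) → kˣ) =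
      pointClass (c * a) (Fin.cons (unitOf a) w : Fin (n + 1) → kˣ) +
        pointClass (c * b) (Fin.cons (unitOf b) w : Fin (n + 1) → kˣ) :=
  additive_of_deviation h2 h3
    (fun c a => pointClass (c * a) (Fin.cons (unitOf a) w : Fin (n + 1) → kˣ))
    (fun c c' a => by rw [add_mul, pointClass_add]) (fun c => by simp)
    (fun c a => by rw [pointClass_cons_neg h2, mul_neg, pointClass_neg])
    (fun c α α' β h h' hβ h1 h1' h1'' =>
      deviation_pointClass w c α α' β h h' hβ h1 h1' h1'' _ fun _ _ => rfl) c a b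

end Relations

/-! ### Generators and relations for Ω^m by logarithmic differentials. -/

section Differentials

variable {k : Type*} [Field k]

theorem dlogUnit_apply (b : Additive kˣ) :
    dlogUnit k b = ((b.toMul : k))⁻¹ • KaehlerDifferential.D ℤ k (b.toMul : k) := by
  rw [← Units.val_inv_eq_inv_val]
  rfl

theorem span_range_dlogUnit : Submodule.span k (Set.range (dlogUnit k)) = ⊤ := by
  rw [eq_top_iff, ← KaehlerDifferential.span_range_derivation, Submodule.span_le]
  rintro _ ⟨a, rfl⟩
  rcases eq_or_ne a 0 with rfl | ha
  · simp
  have : KaehlerDifferential.D ℤ k a = a • dlogUnit k (Additive.ofMul (Units.mk0 a ha)) := by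
    rw [dlogUnit_apply, toMul_ofMul, Units.val_mk0, smul_smul, mul_inv_cancel₀ ha, one_smul]
  rw [this]
  exact Submodule.smul_mem _ _ (Submodule.subset_span ⟨_, rfl⟩)

/-- The relation satisfied by logarithmic differentials, `a dlog a + b dlog b = c dlog c` for
`a + b = c`. -/
def IsDlogAdditive {Q : Type*} [AddCommGroup Q] [Module k Q] (g : Additive kˣ → Q) : Prop :=
  ∀ a b c : kˣ, (a : k) + b = c → (a : k) • g (Additive.ofMul a) + (b : k) • g (Additive.ofMul b) =
    (c : k) • g (Additive.ofMul c)

/-- `Ω¹` is generated by logarithmic differentials, subject only to the relations of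
`IsDlogAdditive`. -/
theorem exists_linearMap_dlogUnit (h2 : (2 : k) ≠ 0) {Q : Type*} [AddCommGroup Q] [Module k Q]
    (g : Additive kˣ →+ Q) (hg : IsDlogAdditive g) :
    ∃ G : Ω[k⁄ℤ] →ₗ[k] Q, ∀ b, G (dlogUnit k b) = g b := by
  classical
  -- The candidate derivation is d a = a g(a); the junk value of `unitOf` at 0 is killed by the
  -- scalar 0.
  let d : k → Q := fun a => a • g (Additive.ofMul (unitOf a))
  -- The hypothesis on `g` says nothing when a + b = 0. That case of additivity needs g(-1) = 0.
  have hm1 : g (Additive.ofMul (-1)) = 0 := by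
    have h : (2 : k) • g (Additive.ofMul (-1)) = 0 := by
      rw [two_smul, ← map_add, ← ofMul_mul, neg_one_mul, neg_neg, ofMul_one, map_zero]
    exact (smul_eq_zero.1 h).resolve_left h2
  have hadd : ∀ a b, d (a + b) = d a + d b := by
    intro a b
    rcases eq_or_ne a 0 with rfl | ha
    · simp [d]
    rcases eq_or_ne b 0 with rfl | hb
    · simp [d]
    rcases eq_or_ne (a + b) 0 with hab | hab
    · have h1 : unitOf b = -1 * unitOf a := by
        ext
        rw [Units.val_mul, coe_unitOf hb, coe_unitOf ha, eq_neg_of_add_eq_zero_right hab]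
        simp
      simp only [d, hab, h1, ofMul_mul, map_add, hm1, zero_add]
      rw [← add_smul, hab, zero_smul, zero_smul]
    · have := hg (unitOf a) (unitOf b) (unitOf (a + b))
        (by rw [coe_unitOf ha, coe_unitOf hb, coe_unitOf hab])
      rw [coe_unitOf ha, coe_unitOf hb, coe_unitOf hab] at this
      exact this.symm
  have hmul : ∀ a b, d (a * b) = a • d b + b • d a := by
    intro a b
    rcases eq_or_ne a 0 with rfl | ha
    · simp [d]
    rcases eq_or_ne b 0 with rfl | hb
    · simp [d]
    simp only [d, unitOf_mul ha hb, ofMul_mul, map_add, smul_add, smul_smul, mul_comm b a]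
    rw [add_comm]
  let δ : Derivation ℤ k Q := Derivation.mk' (AddMonoidHom.mk' d hadd).toIntLinearMap hmul
  refine ⟨δ.liftKaehlerDifferential, fun b => ?_⟩
  rw [dlogUnit_apply, map_smul, Derivation.liftKaehlerDifferential_comp_D]
  change (b.toMul : k)⁻¹ • ((b.toMul : k) • g (Additive.ofMul (unitOf (b.toMul : k)))) = _
  rw [unitOf_coe, inv_smul_smul₀ b.toMul.ne_zero, ofMul_toMul]

theorem multilinearMap_ext_dlogUnit {m : ℕ} {Q : Type*} [AddCommGroup Q] [Module k Q]
    {F G : MultilinearMap k (fun _ : Fin m => Ω[k⁄ℤ]) Q}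
    (h : ∀ b : Fin m → Additive kˣ, (F fun i => dlogUnit k (b i)) = G fun i => dlogUnit k (b i)) :
    F = G := by
  induction m with
  | zero =>
    ext v
    rw [Subsingleton.elim v fun i => dlogUnit k (i.elim0)]
    exact h _
  | succ m ih =>
    apply (multilinearCurryLeftEquiv k (fun _ : Fin (m + 1) => Ω[k⁄ℤ]) Q).injective
    refine LinearMap.ext_on_range span_range_dlogUnit fun b => ih fun w => ?_
    have := h (Fin.cons b w)
    have e : (fun i => dlogUnit k ((Fin.cons b w : Fin (m + 1) → Additive kˣ) i)) =
        Fin.cons (dlogUnit k b) fun i => dlogUnit k (w i) := by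
      ext i
      cases i using Fin.cases <;> rfl
    rw [e] at this
    exact this

/-- By currying: fixing the first entry b gives a multilinear map in the others by induction. A
multilinear map is determined by its values on logarithmic differentials, so this map inherits from
`f` additivity in b and the dlog relation, and the case of Ω¹ applies with multilinear maps as
target. -/
theorem exists_multilinearMap_dlogUnit (h2 : (2 : k) ≠ 0) {m : ℕ} {Q : Type*} [AddCommGroup Q]
    [Module k Q] (f : MultilinearMap ℤ (fun _ : Fin m => Additive kˣ) Q)
    (hf : ∀ i w, IsDlogAdditive fun b => f (Function.update w i b)) :
    ∃ F : MultilinearMap k (fun _ : Fin m => Ω[k⁄ℤ]) Q,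
      ∀ b, (F fun i => dlogUnit k (b i)) = f b := by
  induction m with
  | zero =>
    refine ⟨MultilinearMap.constOfIsEmpty k _ (f 0), fun b => ?_⟩
    rw [Subsingleton.elim b 0]
    rfl
  | succ m ih =>
    have h1 : ∀ b : Additive kˣ, ∃ F : MultilinearMap k (fun _ : Fin m => Ω[k⁄ℤ]) Q,
        ∀ w, (F fun i => dlogUnit k (w i)) = f (Fin.cons b w) := by
      intro b
      refine ih (f.curryLeft b) fun i w => ?_
      have := hf i.succ (Fin.cons b w)
      simpa only [← Fin.cons_update, MultilinearMap.curryLeft_apply] using this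
    choose F hF using h1
    let g : Additive kˣ →+ MultilinearMap k (fun _ : Fin m => Ω[k⁄ℤ]) Q :=
      AddMonoidHom.mk' F fun b b' => multilinearMap_ext_dlogUnit fun w => by
        rw [add_apply, hF, hF, hF, MultilinearMap.cons_add]
    obtain ⟨G, hG⟩ := exists_linearMap_dlogUnit h2 g fun a b c habc =>
      multilinearMap_ext_dlogUnit fun w => by
        have := hf 0 (Fin.cons 0 w) a b c habc
        simp only [Fin.update_cons_zero, ← hF] at this
        exact this
    refine ⟨G.uncurryLeft, fun b => ?_⟩
    rw [LinearMap.uncurryLeft_apply, hG]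
    change F (b 0) (fun i => dlogUnit k (b i.succ)) = f b
    rw [hF (b 0) fun i => b i.succ]
    exact congrArg f (Fin.cons_self_tail b)

/-- Antisymmetry can be tested on logarithmic differentials, where it comes from `f`; as 2 is
invertible, antisymmetric implies alternating. -/
theorem exists_alternatingMap_dlogUnit (h2 : (2 : k) ≠ 0) {m : ℕ} {Q : Type*} [AddCommGroup Q]
    [Module k Q] (f : Additive kˣ [⋀^Fin m]→ₗ[ℤ] Q)
    (hf : ∀ i w, IsDlogAdditive fun b => f (Function.update w i b)) :
    ∃ F : Ω[k⁄ℤ] [⋀^Fin m]→ₗ[k] Q, ∀ b, (F fun i => dlogUnit k (b i)) = f b := by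
  obtain ⟨F, hF⟩ := exists_multilinearMap_dlogUnit h2 f.toMultilinearMap hf
  refine ⟨{ F with map_eq_zero_of_eq' := fun v i j hv hij => ?_ }, hF⟩
  have hswap : F.domDomCongr (Equiv.swap i j) = -F := multilinearMap_ext_dlogUnit fun b => by
    rw [MultilinearMap.domDomCongr_apply, neg_apply, hF b,
      hF fun l => b (Equiv.swap i j l)]
    exact f.map_swap b hij
  have h1 := congrArg (fun F => F v) hswap
  simp only [MultilinearMap.domDomCongr_apply, neg_apply] at h1
  have h3 : (fun l => v (Equiv.swap i j l)) = v := by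
    ext l
    rcases eq_or_ne l i with rfl | hi
    · rw [Equiv.swap_apply_left, hv]
    rcases eq_or_ne l j with rfl | hj
    · rw [Equiv.swap_apply_right, hv]
    rw [Equiv.swap_apply_of_ne_of_ne hi hj]
  rw [h3, eq_neg_iff_add_eq_zero, ← two_smul k] at h1
  exact (smul_eq_zero.1 h1).resolve_left h2

theorem linearMap_tensor_exteriorPower_ext {m : ℕ} {A Q : Type*} [AddCommGroup A]
    [AddCommGroup Q] [Module k Q] {f g : k ⊗[ℤ] (⋀[ℤ]^m A) →ₗ[k] Q}
    (h : ∀ b : Fin m → A, f (1 ⊗ₜ exteriorPower.ιMulti ℤ m b) =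
      g (1 ⊗ₜ exteriorPower.ιMulti ℤ m b)) : f = g := by
  have h1 : ((LinearMap.restrictScalars ℤ f).comp (TensorProduct.mk ℤ k (⋀[ℤ]^m A) 1)) =
      (LinearMap.restrictScalars ℤ g).comp (TensorProduct.mk ℤ k (⋀[ℤ]^m A) 1) :=
    exteriorPower.linearMap_ext (AlternatingMap.ext h)
  have h2 : ∀ x : ⋀[ℤ]^m A, f (1 ⊗ₜ x) = g (1 ⊗ₜ x) := fun x => LinearMap.congr_fun h1 x
  refine LinearMap.ext fun z => ?_
  induction z using TensorProduct.induction_on with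
  | zero => rw [map_zero, map_zero]
  | add z z' h h' => rw [map_add, map_add, h, h']
  | tmul a x =>
    have h3 : a ⊗ₜ[ℤ] x = a • ((1 : k) ⊗ₜ[ℤ] x) := by
      rw [TensorProduct.smul_tmul', smul_eq_mul, mul_one]
    rw [h3, map_smul, map_smul, h2]

theorem dlog_one_tmul_ιMulti {m : ℕ} (b : Fin m → Additive kˣ) :
    dlog k m (1 ⊗ₜ exteriorPower.ιMulti ℤ m b) =
      exteriorPower.ιMulti k m fun i => dlogUnit k (b i) := by
  rw [dlog, LinearMap.liftBaseChange_tmul, one_smul,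
    exteriorPower.alternatingMapLinearEquiv_apply_ιMulti]
  rfl

/-- A homomorphism on `k ⊗ ⋀^m k^×` that respects the relations of logarithmic differentials
factors through `Ω^m`. -/
theorem exists_comp_dlog_eq (h2 : (2 : k) ≠ 0) {m : ℕ} {T : Type*} [AddCommGroup T]
    (Φ : k ⊗[ℤ] (⋀[ℤ]^m (Additive kˣ)) →+ T)
    (hΦ : ∀ (i : Fin m) (w : Fin m → Additive kˣ) (c : k) (a b d : kˣ), (a : k) + b = d →
      Φ ((c * a) ⊗ₜ exteriorPower.ιMulti ℤ m (Function.update w i (Additive.ofMul a))) +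
        Φ ((c * b) ⊗ₜ exteriorPower.ιMulti ℤ m (Function.update w i (Additive.ofMul b))) =
      Φ ((c * d) ⊗ₜ exteriorPower.ιMulti ℤ m (Function.update w i (Additive.ofMul d)))) :
    ∃ φ : ⋀[k]^m Ω[k⁄ℤ] →+ T, φ.comp (dlog k m).toAddMonoidHom = Φ := by
  -- The target T has no k-module structure, so Φ is replaced by the quotient by the largest
  -- k-submodule of its kernel. The factor `c` in `hΦ` puts the dlog relations into this submodule.
  let N : Submodule k (k ⊗[ℤ] (⋀[ℤ]^m (Additive kˣ))) :=
    { carrier := {z | ∀ c : k, Φ (c • z) = 0}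
      zero_mem' := fun c => by rw [smul_zero, map_zero]
      add_mem' := fun {a b} ha hb c => by rw [smul_add, map_add, ha, hb, add_zero]
      smul_mem' := fun c' z hz c => by rw [smul_smul]; exact hz _ }
  have hN : N.toAddSubgroup ≤ Φ.ker := fun z hz => by
    have := hz 1
    rwa [one_smul] at this
  let f : Additive kˣ [⋀^Fin m]→ₗ[ℤ] ((k ⊗[ℤ] (⋀[ℤ]^m (Additive kˣ))) ⧸ N) :=
    ((N.mkQ.restrictScalars ℤ).comp (TensorProduct.mk ℤ k _ 1)).compAlternatingMap
      (exteriorPower.ιMulti ℤ m)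
  have hf : ∀ b, f b = N.mkQ ((1 : k) ⊗ₜ exteriorPower.ιMulti ℤ m b) := fun b => rfl
  obtain ⟨F, hF⟩ := exists_alternatingMap_dlogUnit h2 f fun i w a b d habd => by
    simp only [hf]
    rw [← map_smul, ← map_smul, ← map_smul, ← map_add, ← sub_eq_zero, ← map_sub,
      Submodule.mkQ_apply, Submodule.Quotient.mk_eq_zero]
    intro c
    rw [smul_sub, smul_add, map_sub, map_add, sub_eq_zero]
    simpa only [TensorProduct.smul_tmul', smul_eq_mul, mul_one] using hΦ i w c a b d habd
  let L : ⋀[k]^m Ω[k⁄ℤ] →ₗ[k] ((k ⊗[ℤ] (⋀[ℤ]^m (Additive kˣ))) ⧸ N) :=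
    exteriorPower.alternatingMapLinearEquiv F
  have hL : ∀ z, L (dlog k m z) = N.mkQ z := by
    refine fun z => LinearMap.congr_fun (f := L.comp (dlog k m)) (g := N.mkQ)
      (linearMap_tensor_exteriorPower_ext fun b => ?_) z
    rw [LinearMap.comp_apply, dlog_one_tmul_ιMulti, ← hf, ← hF]
    exact exteriorPower.alternatingMapLinearEquiv_apply_ιMulti F _
  exact ⟨(QuotientAddGroup.lift N.toAddSubgroup Φ hN).comp L.toAddMonoidHom,
    AddMonoidHom.ext fun z => congrArg (QuotientAddGroup.lift N.toAddSubgroup Φ hN) (hL z)⟩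

end Differentials

/-! ### Homomorphisms out of the tensor product with an exterior power. -/

section Universal

/-- Functions that are additive in `a` and alternating in `b` define homomorphisms on
`k ⊗ ⋀^m A`. -/
theorem exists_addMonoidHom_tensor_exteriorPower {R A T : Type*} [AddCommGroup R] [AddCommGroup A]
    [AddCommGroup T] {m : ℕ} (P : R → (Fin m → A) → T)
    (hadd : ∀ r r' b, P (r + r') b = P r b + P r' b)
    (hupd : ∀ r b i x y, P r (Function.update b i (x + y)) =
      P r (Function.update b i x) + P r (Function.update b i y))
    (halt : ∀ r b i j, b i = b j → i ≠ j → P r b = 0) :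
    ∃ Φ : R ⊗[ℤ] (⋀[ℤ]^m A) →+ T, ∀ r b, Φ (r ⊗ₜ exteriorPower.ιMulti ℤ m b) = P r b := by
  let p : (Fin m → A) → R →ₗ[ℤ] T := fun b =>
    (AddMonoidHom.mk' (fun r => P r b) fun r r' => hadd r r' b).toIntLinearMap
  have hp : ∀ b i x y, p (Function.update b i (x + y)) =
      p (Function.update b i x) + p (Function.update b i y) :=
    fun b i x y => LinearMap.ext fun r => hupd r b i x y
  let f : A [⋀^Fin m]→ₗ[ℤ] (R →ₗ[ℤ] T) :=
    { MultilinearMap.mk' p hp fun b i c x =>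
        (AddMonoidHom.mk' (fun z => p (Function.update b i z)) (hp b i)).toIntLinearMap.map_smul c x
        with
      map_eq_zero_of_eq' := fun b i j h hij => LinearMap.ext fun r => halt r b i j h hij }
  refine ⟨(TensorProduct.lift (exteriorPower.alternatingMapLinearEquiv f).flip).toAddMonoidHom,
    fun r b => ?_⟩
  exact (TensorProduct.lift.tmul _ _).trans (LinearMap.congr_fun
    (exteriorPower.alternatingMapLinearEquiv_apply_ιMulti f b) r)

/-- This carries relations proved for slot 0 to any other slot. -/
theorem tmul_ιMulti_update_eq_neg {R A : Type*} [AddCommGroup R] [AddCommGroup A] {m : ℕ} (r : R)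
    (w : Fin (m + 1) → A) {i : Fin (m + 1)} (hi : i ≠ 0) (x : A) :
    r ⊗ₜ[ℤ] exteriorPower.ιMulti ℤ (m + 1) (Function.update w i x) =
      -(r ⊗ₜ[ℤ] exteriorPower.ιMulti ℤ (m + 1) (Function.update (w ∘ Equiv.swap i 0) 0 x)) := by
  have h := (exteriorPower.ιMulti ℤ (m + 1)).map_swap (Function.update w i x) hi
  rw [Function.update_comp_equiv, Equiv.symm_swap, Equiv.swap_apply_left] at h
  rw [h, TensorProduct.tmul_neg, neg_neg]

end Universal

/-! ### Assembly of Φ and of the relations it respects. -/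

section Relations

variable {k : Type*} [Field k]

theorem exists_addMonoidHom_pointClass (h2 : (2 : k) ≠ 0) (m : ℕ) :
    ∃ Φ : k ⊗[ℤ] (⋀[ℤ]^m (Additive kˣ)) →+ TH k m, ∀ a (b : Fin m → Additive kˣ),
      Φ (a ⊗ₜ exteriorPower.ιMulti ℤ m b) = pointClass a fun i => (b i).toMul :=
  exists_addMonoidHom_tensor_exteriorPower
    (P := fun a (b : Fin m → Additive kˣ) => pointClass a fun i => (b i).toMul)
    (fun a a' b => pointClass_add a a' _)
    (fun a b i x y => by
      have h := fun z : Additive kˣ => funext fun j =>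
        Function.apply_update (fun _ => Additive.toMul) b i z j
      simp only [h]
      exact pointClass_update_mul a _ i _ _)
    fun a b i j h hij =>
      pointClass_eq_zero_of_eq h2 a (fun l => (b l).toMul) hij (congrArg Additive.toMul h)

/-- In slot 0 this is `pointClass_mul_cons_add`; another slot is swapped with slot 0, at the cost of
a common sign. -/
theorem update_add_of_forall_pointClass (h2 : (2 : k) ≠ 0) (h3 : (3 : k) ≠ 0) {m : ℕ}
    (Φ : k ⊗[ℤ] (⋀[ℤ]^m (Additive kˣ)) →+ TH k m)
    (hΦ : ∀ a (b : Fin m → Additive kˣ),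
      Φ (a ⊗ₜ exteriorPower.ιMulti ℤ m b) = pointClass a fun i => (b i).toMul)
    (i : Fin m) (w : Fin m → Additive kˣ) (c : k) {a b d : kˣ} (h : (a : k) + b = d) :
    Φ ((c * a) ⊗ₜ exteriorPower.ιMulti ℤ m (Function.update w i (Additive.ofMul a))) +
        Φ ((c * b) ⊗ₜ exteriorPower.ιMulti ℤ m (Function.update w i (Additive.ofMul b))) =
      Φ ((c * d) ⊗ₜ exteriorPower.ιMulti ℤ m (Function.update w i (Additive.ofMul d))) := by
  obtain _ | m := m
  · exact i.elim0
  have key : ∀ v : Fin (m + 1) → Additive kˣ,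
      Φ ((c * a) ⊗ₜ exteriorPower.ιMulti ℤ _ (Function.update v 0 (Additive.ofMul a))) +
        Φ ((c * b) ⊗ₜ exteriorPower.ιMulti ℤ _ (Function.update v 0 (Additive.ofMul b))) =
      Φ ((c * d) ⊗ₜ exteriorPower.ιMulti ℤ _ (Function.update v 0 (Additive.ofMul d))) := by
    intro v
    have e : ∀ a : kˣ, (fun i => (Function.update v 0 (Additive.ofMul a) i).toMul) =
        (Fin.cons (unitOf (a : k)) fun i => (v i.succ).toMul : Fin (m + 1) → kˣ) := by
      intro a
      ext i
      cases i using Fin.cases <;> simp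
    simp only [hΦ, e]
    rw [← pointClass_mul_cons_add h2 h3, h]
  rcases eq_or_ne i 0 with rfl | hi
  · exact key w
  simp only [tmul_ιMulti_update_eq_neg _ w hi, map_neg, ← key, neg_add]

end Relations

end AdditiveChow

end

theorem mainTheorem3 {k : Type*} [Field k] (h6 : (6 : k) ≠ 0) (n : ℕ) (hn : 1 ≤ n) :
    ∃ Φ : k ⊗[ℤ] (⋀[ℤ]^(n - 1) (Additive kˣ)) →+ AdditiveChow.TH k (n - 1),
      (∀ (a : k) (b : Fin (n - 1) → kˣ),
        Φ (a ⊗ₜ[ℤ] exteriorPower.ιMulti ℤ (n - 1) (fun i => Additive.ofMul (b i))) =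
          AdditiveChow.pointClass a b) ∧
      ∃ φ : ⋀[k]^(n - 1) Ω[k⁄ℤ] →+ AdditiveChow.TH k (n - 1),
        φ.comp (AdditiveChow.dlog k (n - 1)).toAddMonoidHom = Φ := by
  have h23 : (2 : k) * 3 ≠ 0 := by
    rwa [show (2 : k) * 3 = 6 by norm_num]
  have h2 := left_ne_zero_of_mul h23
  obtain ⟨Φ, hΦ⟩ := AdditiveChow.exists_addMonoidHom_pointClass h2 (n - 1)
  exact ⟨Φ, fun a b => hΦ a _, AdditiveChow.exists_comp_dlog_eq h2 Φ fun i w c _ _ _ h =>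
    AdditiveChow.update_add_of_forall_pointClass h2 (right_ne_zero_of_mul h23) Φ hΦ i w c h⟩
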